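/- Let $\mathbb D=\{z\in\mathbb C: |z|\le 1\}$ be the Euclidean unit disk with Lebesgue measure, and parametrize the inward-pointing boundary $\partial_+S\mathbb D$ by $(\beta,\alpha)\in\mathbb S^1\times(-\pi/2,\pi/2)$, where $e^{i\beta}$ is the boundary point and $e^{i(\beta+\pi+\alpha)}$ the direction. Let $$I_0f(\beta,\alpha)=\int_0^{2\cos\alpha} f\big(e^{i\beta}+t\,e^{i(\beta+\pi+\alpha)}\big)\,dt$$ be the X-ray transform, a bounded operator $I_0:L^2(\mathbb D)\to L^2(\partial_+S\mathbb D,d\beta\,d\alpha)$ between spaces of complex-valued functions, and let $I_0^*$ be its adjoint. For $n\ge 0$, $0\le k\le n$ let $$Z_{n,k}=I_0^*\psi_{n,k},\qquad \psi_{n,k}(\beta,\alpha)=\frac{(-1)^n}{4\pi}e^{i(n-2k)(\beta+\alpha)}\big(e^{i(n+1)\alpha}+(-1)^ne^{-i(n+1)\alpha}\big)$$ be the Zernike functions, $\widehat{Z_{n,k}}=Z_{n,k}/\|Z_{n,k}\|_{L^2(\mathbb D)}$, and let $$\widetilde H^1(\mathbb D)=\Big\{f=\sum_{n\ge0}\sum_{k=0}^n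 f_{n,k}\widehat{Z_{n,k}}\ :\ \sum_{n\ge0}(n+1)^2\sum_{k=0}^n|f_{n,k}|^2<\infty\Big\}\subset L^2(\mathbb D).$$ Let $H^1(\mathbb D)$ be the space of all $u\in L^2(\mathbb D)$ whose weak gradient on the open disk is in $L^2(\mathbb D)$, with $\|u\|_{H^1}^2=\|u\|_{L^2}^2+\|\nabla u\|_{L^2}^2$. Then: 1. $I_0^*I_0$ is not bounded from $L^2(\mathbb D)$ to $H^1(\mathbb D)$. 2. The norm inequality already fails on the Zernike functions $Z_{n,n/2}$ with $n$ even: for every $C\in\mathbb R$ there is an even $n\ge 0$ such that $I_0^*I_0Z_{n,n/2}\in H^1(\mathbb D)$ and $\|I_0^*I_0Z_{n,n/2}\|_{H^1}>C\,\|Z_{n,n/2}\|_{L^2}$. 3. $H^1(\mathbb D)\subsetneq\widetilde H^1(\mathbb D)$. 4. $I_0^*I_0(L^2(\mathbb D))=\widetilde H^1(\mathbb D)$. -/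

import Mathlib

open MeasureTheory Set
open scoped ENNReal ContDiff

noncomputable section

namespace DiskXRay

/-! ### The disk, the inward boundary and the X-ray transform -/

/-- Lebesgue measure on the closed Euclidean unit disk, the plane being identified with `ℂ`. -/
def diskMeasure : Measure ℂ := volume.restrict (Metric.closedBall (0 : ℂ) 1)

/-- The measure `dβ dα` on the inward-pointing boundary `∂₊SD`, in fan-beam coordinates
`(β, α) ∈ 𝕊¹ × (-π/2, π/2)`, the circle being represented by the period `(0, 2π]`. -/
def fanMeasure : Measure (ℝ × ℝ) :=
  (volume.restrict (Ioc 0 (2 * Real.pi))).prod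
    (volume.restrict (Ioo (-(Real.pi / 2)) (Real.pi / 2)))

/-- The complex Hilbert space `L²(D)`. -/
abbrev L2Disk := Lp ℂ 2 diskMeasure

/-- The complex Hilbert space `L²(∂₊SD, dβ dα)`. -/
abbrev L2Fan := Lp ℂ 2 fanMeasure

/-- The point at time `t` of the unit speed line that starts at the boundary point `e^{iβ}` in the
direction `v = e^{i(β + π + α)}`; here `p = (β, α)`. -/
def ray (p : ℝ × ℝ) (t : ℝ) : ℂ :=
  Complex.exp (p.1 * Complex.I) + t * Complex.exp ((p.1 + Real.pi + p.2 : ℝ) * Complex.I)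

/-- The first exit time of the line with fan-beam coordinates `p = (β, α)` (see
`ray_mem_disk_iff`). -/
def exitTime (p : ℝ × ℝ) : ℝ := 2 * Real.cos p.2

/-- The X-ray transform of a function on the disk,
`I₀ f (β, α) = ∫₀^{τ(β, α)} f(γ_{β, α}(t)) dt`. -/
def xray (f : ℂ → ℂ) (p : ℝ × ℝ) : ℂ := ∫ t in (0 : ℝ)..exitTime p, f (ray p t)

instance : IsFiniteMeasure diskMeasure :=
  ⟨by simp [diskMeasure]⟩

instance : IsFiniteMeasure fanMeasure := by
  unfold fanMeasure; infer_instance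

lemma continuous_ray : Continuous (fun q : (ℝ × ℝ) × ℝ => ray q.1 q.2) := by
  unfold ray; fun_prop

lemma ray_eq (p : ℝ × ℝ) (t : ℝ) :
    ray p t = -Complex.exp ((p.1 + p.2 : ℝ) * Complex.I) *
      ⟨t - Real.cos p.2, Real.sin p.2⟩ := by
  have h1 : Complex.exp (p.1 * Complex.I) = Complex.exp ((p.1 + p.2 : ℝ) * Complex.I) *
      Complex.exp (-p.2 * Complex.I) := by
    rw [← Complex.exp_add]; congr 1; push_cast; ring
  have h2 : Complex.exp ((p.1 + Real.pi + p.2 : ℝ) * Complex.I) =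
      -Complex.exp ((p.1 + p.2 : ℝ) * Complex.I) := by
    rw [show ((p.1 + Real.pi + p.2 : ℝ) * Complex.I) =
      ((p.1 + p.2 : ℝ) * Complex.I) + Real.pi * Complex.I by push_cast; ring,
      Complex.exp_add, Complex.exp_pi_mul_I]; ring
  have h3 : (⟨t - Real.cos p.2, Real.sin p.2⟩ : ℂ) = t - Complex.exp (-p.2 * Complex.I) := by
    rw [Complex.exp_mul_I]
    apply Complex.ext
    · simp [Complex.cos_ofReal_re]
    · simp [Complex.sin_ofReal_re]
  rw [ray, h1, h2, h3]; ring

lemma norm_ray_sq (p : ℝ × ℝ) (t : ℝ) :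
    ‖ray p t‖ ^ 2 = 1 - t * (exitTime p - t) := by
  rw [ray_eq, norm_mul, norm_neg, Complex.norm_exp_ofReal_mul_I, one_mul, Complex.sq_norm,
    Complex.normSq_mk, exitTime]
  nlinarith [Real.sin_sq_add_cos_sq p.2]

/-- For `α ∈ (-π/2, π/2)`, the part of the line inside the disk is exactly `0 ≤ t ≤ τ`. -/
lemma ray_mem_disk_iff (p : ℝ × ℝ) (t : ℝ)
    (hp : p.2 ∈ Ioo (-(Real.pi / 2)) (Real.pi / 2)) :
    ray p t ∈ Metric.closedBall (0 : ℂ) 1 ↔ t ∈ Icc 0 (exitTime p) := by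
  have hc : 0 < exitTime p := mul_pos two_pos (Real.cos_pos_of_mem_Ioo hp)
  rw [mem_closedBall_zero_iff, ← sq_le_one_iff₀ (norm_nonneg _), norm_ray_sq, mem_Icc]
  constructor
  · intro h
    have h' : 0 ≤ t * (exitTime p - t) := by linarith
    constructor
    · by_contra! ht
      nlinarith [mul_pos (neg_pos.2 ht) (by linarith : 0 < exitTime p - t)]
    · by_contra! ht
      nlinarith [mul_pos (by linarith : 0 < t) (sub_pos.2 ht)]
  · rintro ⟨h0, h1⟩
    nlinarith [mul_nonneg h0 (sub_nonneg.2 h1)]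

lemma ae_fan_cos_pos : ∀ᵐ p ∂fanMeasure, p.2 ∈ Ioo (-(Real.pi / 2)) (Real.pi / 2) := by
  unfold fanMeasure
  have h : ∀ᵐ a ∂(volume.restrict (Ioo (-(Real.pi / 2)) (Real.pi / 2))),
      a ∈ Ioo (-(Real.pi / 2)) (Real.pi / 2) := ae_restrict_mem measurableSet_Ioo
  exact Measure.quasiMeasurePreserving_snd.ae h

lemma lintegral_sin_le (H : ℝ → ℝ≥0∞) :
    ∫⁻ a in Ioo (-(Real.pi / 2)) (Real.pi / 2), ENNReal.ofReal (Real.cos a) * H (Real.sin a)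
      ≤ ∫⁻ u, H u := by
  have h := lintegral_image_eq_lintegral_abs_deriv_mul
    (s := Ioo (-(Real.pi / 2)) (Real.pi / 2)) (f := Real.sin) (f' := Real.cos)
    measurableSet_Ioo (fun x _ => (Real.hasDerivAt_sin x).hasDerivWithinAt)
    (Real.injOn_sin.mono Ioo_subset_Icc_self) H
  calc _ = ∫⁻ a in Ioo (-(Real.pi / 2)) (Real.pi / 2),
        ENNReal.ofReal |Real.cos a| * H (Real.sin a) := by
        refine setLIntegral_congr_fun measurableSet_Ioo fun a ha => ?_
        simp only [abs_of_pos (Real.cos_pos_of_mem_Ioo ha)]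
    _ = _ := h.symm
    _ ≤ _ := setLIntegral_le_lintegral _ _

lemma lintegral_rotate (F : ℂ → ℝ≥0∞) (hF : Measurable F) (b : ℝ) :
    ∫⁻ u : ℝ, ∫⁻ s : ℝ, F (-Complex.exp (b * Complex.I) * ⟨s, u⟩) = ∫⁻ z, F z := by
  have hG : Measurable fun z => F (-Complex.exp (b * Complex.I) * z) := by fun_prop
  have h1 : ∫⁻ z, F (-Complex.exp (b * Complex.I) * z) = ∫⁻ z, F z := by
    let c : Circle := ⟨-Complex.exp (b * Complex.I), by
      simp [Submonoid.unitSphere, Complex.norm_exp_ofReal_mul_I]⟩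
    have := (rotation c).measurePreserving.lintegral_comp hF
    exact this
  rw [← h1, ← (Complex.volume_preserving_equiv_real_prod.symm).lintegral_comp hG,
    Measure.volume_eq_prod, lintegral_prod_symm _ (by fun_prop)]
  rfl

lemma measurableSet_chord : MeasurableSet {q : (ℝ × ℝ) × ℝ | q.2 ∈ Ioc 0 (exitTime q.1)} := by
  unfold exitTime
  exact (measurableSet_lt measurable_const measurable_snd).inter
    (measurableSet_le measurable_snd (by fun_prop))

lemma measurable_lintegral_chord (F : ℂ → ℝ≥0∞) (hF : Measurable F) :
    Measurable fun p : ℝ × ℝ => ∫⁻ t in Ioc 0 (exitTime p), F (ray p t) := by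
  have h : Measurable ({q : (ℝ × ℝ) × ℝ | q.2 ∈ Ioc 0 (exitTime q.1)}.indicator
      fun q => F (ray q.1 q.2)) :=
    (hF.comp continuous_ray.measurable).indicator measurableSet_chord
  have e : (fun p : ℝ × ℝ => ∫⁻ t in Ioc 0 (exitTime p), F (ray p t)) = fun p =>
      ∫⁻ t, {q : (ℝ × ℝ) × ℝ | q.2 ∈ Ioc 0 (exitTime q.1)}.indicator
        (fun q => F (ray q.1 q.2)) (p, t) := by
    funext p
    rw [← lintegral_indicator measurableSet_Ioc]
    rfl
  rw [e]
  exact h.lintegral_prod_right'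

lemma lintegral_swap_cos (μ ν : Measure ℝ) [SFinite μ] [SFinite ν] (K : ℝ × ℝ → ℝ≥0∞)
    (hK : Measurable K) :
    ∫⁻ a, ∫⁻ b, ENNReal.ofReal (Real.cos a) * K (b, a) ∂ν ∂μ =
      ∫⁻ b, ∫⁻ a, ENNReal.ofReal (Real.cos a) * K (b, a) ∂μ ∂ν := by
  have h : Measurable fun q : ℝ × ℝ => ENNReal.ofReal (Real.cos q.1) * K (q.2, q.1) := by
    fun_prop
  exact lintegral_lintegral_swap h.aemeasurable

lemma measurable_lineIntegral (F : ℂ → ℝ≥0∞) (hF : Measurable F) :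
    Measurable fun q : ℝ × ℝ =>
      ∫⁻ s : ℝ, F (-Complex.exp (q.1 * Complex.I) * ⟨s, Real.sin q.2⟩) := by
  have h1 : Continuous fun q : (ℝ × ℝ) × ℝ => (⟨q.2, Real.sin q.1.2⟩ : ℂ) := by
    simp_rw [Complex.mk_eq_add_mul_I]
    fun_prop
  have h : Continuous fun q : (ℝ × ℝ) × ℝ =>
      -Complex.exp (q.1.1 * Complex.I) * (⟨q.2, Real.sin q.1.2⟩ : ℂ) :=
    (by fun_prop : Continuous fun q : (ℝ × ℝ) × ℝ =>
      -Complex.exp (q.1.1 * Complex.I)).mul h1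
  exact (hF.comp h.measurable).lintegral_prod_right'

/-- The inequality in Santaló's formula on the disk. -/
lemma santalo_le (F : ℂ → ℝ≥0∞) (hF : Measurable F) :
    ∫⁻ p, ENNReal.ofReal (Real.cos p.2) *
        (∫⁻ t in Ioc 0 (exitTime p), F (ray p t)) ∂fanMeasure
      ≤ ENNReal.ofReal (2 * Real.pi) * ∫⁻ z, F z ∂diskMeasure := by
  obtain ⟨F', hF'⟩ : ∃ F' : ℂ → ℝ≥0∞, F' = (Metric.closedBall (0 : ℂ) 1).indicator F := ⟨_, rfl⟩
  have hm : Measurable F' := hF' ▸ hF.indicator Metric.isClosed_closedBall.measurableSet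
  have hmr : Measurable fun q : (ℝ × ℝ) × ℝ => F' (ray q.1 q.2) :=
    hm.comp continuous_ray.measurable
  have hmi : Measurable fun p : ℝ × ℝ => ∫⁻ t, F' (ray p t) := hmr.lintegral_prod_right'
  have step1 : ∫⁻ p, ENNReal.ofReal (Real.cos p.2) *
        (∫⁻ t in Ioc 0 (exitTime p), F (ray p t)) ∂fanMeasure
      ≤ ∫⁻ p, ENNReal.ofReal (Real.cos p.2) * (∫⁻ t, F' (ray p t)) ∂fanMeasure := by
    refine lintegral_mono_ae ?_
    filter_upwards [ae_fan_cos_pos] with p hp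
    refine mul_le_mul_right ?_ _
    rw [← lintegral_indicator measurableSet_Ioc]
    refine lintegral_mono fun t => ?_
    by_cases ht : t ∈ Ioc 0 (exitTime p)
    · rw [indicator_of_mem ht, hF', indicator_of_mem]
      exact (ray_mem_disk_iff p t hp).2 (Ioc_subset_Icc_self ht)
    · simp [ht]
  refine step1.trans ?_
  have hshift : ∀ a : ℝ, ∀ b : ℝ, ∫⁻ t, F' (ray (b, a) t) =
      ∫⁻ s : ℝ, F' (-Complex.exp ((b + a : ℝ) * Complex.I) * ⟨s, Real.sin a⟩) := by
    intro a b
    simp_rw [ray_eq]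
    exact lintegral_sub_right_eq_self (μ := volume)
      (fun s : ℝ => F' (-Complex.exp ((b + a : ℝ) * Complex.I) * ⟨s, Real.sin a⟩)) (Real.cos a)
  have hper : ∀ a : ℝ, ∫⁻ b in Ioc 0 (2 * Real.pi),
        ∫⁻ s : ℝ, F' (-Complex.exp ((b + a : ℝ) * Complex.I) * ⟨s, Real.sin a⟩) =
      ∫⁻ b in Ioc 0 (2 * Real.pi),
        ∫⁻ s : ℝ, F' (-Complex.exp (b * Complex.I) * ⟨s, Real.sin a⟩) := by
    intro a
    set K : ℝ → ℝ≥0∞ := fun b =>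
      ∫⁻ s : ℝ, F' (-Complex.exp (b * Complex.I) * ⟨s, Real.sin a⟩) with hK
    have hKper : Function.Periodic K (2 * Real.pi) := by
      intro b
      simp only [hK]
      rw [show ((b + 2 * Real.pi : ℝ) * Complex.I) = b * Complex.I + 2 * Real.pi * Complex.I by
        push_cast; ring, Complex.exp_periodic]
    have e1 : ∫⁻ b in Ioc 0 (2 * Real.pi), K (b + a) =
        ∫⁻ b in Ioc a (a + 2 * Real.pi), K b := by
      rw [← lintegral_indicator measurableSet_Ioc, ← lintegral_indicator measurableSet_Ioc,
        ← lintegral_add_right_eq_self (fun b => (Ioc a (a + 2 * Real.pi)).indicator K b) a]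
      congr 1 with b
      simp only [indicator, mem_Ioc]
      have : (0 < b ∧ b ≤ 2 * Real.pi) ↔ (a < b + a ∧ b + a ≤ a + 2 * Real.pi) := by
        constructor <;> rintro ⟨_, _⟩ <;> constructor <;> linarith
      simp only [this]
    have e2 : ∫⁻ b in Ioc a (a + 2 * Real.pi), K b = ∫⁻ b in Ioc 0 (0 + 2 * Real.pi), K b := by
      refine (isAddFundamentalDomain_Ioc Real.two_pi_pos a).setLIntegral_eq
        (isAddFundamentalDomain_Ioc Real.two_pi_pos 0) K ?_
      rintro ⟨g, n, rfl⟩ b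
      have := hKper.int_mul n b
      simp only [hK] at this ⊢
      simpa [add_comm, AddSubgroup.vadd_def] using this
    rw [zero_add] at e2
    exact e1.trans e2
  have hmK := measurable_lineIntegral F' hm
  have hcos : Measurable fun a : ℝ => ENNReal.ofReal (Real.cos a) := by fun_prop
  calc ∫⁻ p, ENNReal.ofReal (Real.cos p.2) * (∫⁻ t, F' (ray p t)) ∂fanMeasure
      = ∫⁻ a in Ioo (-(Real.pi / 2)) (Real.pi / 2), ∫⁻ b in Ioc 0 (2 * Real.pi),
          ENNReal.ofReal (Real.cos a) * (∫⁻ t, F' (ray (b, a) t)) := by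
        rw [fanMeasure, lintegral_prod_symm]
        exact ((hcos.comp measurable_snd).mul hmi).aemeasurable
    _ = ∫⁻ a in Ioo (-(Real.pi / 2)) (Real.pi / 2), ∫⁻ b in Ioc 0 (2 * Real.pi),
          ENNReal.ofReal (Real.cos a) *
          (∫⁻ s : ℝ, F' (-Complex.exp (b * Complex.I) * ⟨s, Real.sin a⟩)) := by
        refine lintegral_congr fun a => ?_
        rw [lintegral_const_mul' _ _ ENNReal.ofReal_ne_top,
          lintegral_const_mul' _ _ ENNReal.ofReal_ne_top, ← hper a]
        simp_rw [hshift a]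
    _ = ∫⁻ b in Ioc 0 (2 * Real.pi), ∫⁻ a in Ioo (-(Real.pi / 2)) (Real.pi / 2),
          ENNReal.ofReal (Real.cos a) *
          (∫⁻ s : ℝ, F' (-Complex.exp (b * Complex.I) * ⟨s, Real.sin a⟩)) := by
        exact lintegral_swap_cos (volume.restrict (Ioo (-(Real.pi / 2)) (Real.pi / 2)))
          (volume.restrict (Ioc 0 (2 * Real.pi))) (fun q : ℝ × ℝ =>
          ∫⁻ s : ℝ, F' (-Complex.exp (q.1 * Complex.I) * ⟨s, Real.sin q.2⟩)) hmK
    _ ≤ ∫⁻ b in Ioc 0 (2 * Real.pi), ∫⁻ z, F' z := by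
        refine lintegral_mono fun b => ?_
        refine (lintegral_sin_le
          (fun u => ∫⁻ s : ℝ, F' (-Complex.exp (b * Complex.I) * ⟨s, u⟩))).trans ?_
        rw [lintegral_rotate F' hm b]
    _ = ENNReal.ofReal (2 * Real.pi) * ∫⁻ z, F z ∂diskMeasure := by
        rw [setLIntegral_const, hF', lintegral_indicator Metric.isClosed_closedBall.measurableSet,
          diskMeasure, Real.volume_Ioc, sub_zero, mul_comm]

/-- A property that holds almost everywhere in the disk holds almost everywhere on almost every
chord. -/
lemma ae_ray {P : ℂ → Prop} (h : ∀ᵐ z ∂diskMeasure, P z) :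
    ∀ᵐ p ∂fanMeasure, ∀ᵐ t ∂(volume.restrict (Ioc 0 (exitTime p))), P (ray p t) := by
  obtain ⟨N, hN, hNm, hN0⟩ := exists_measurable_superset_of_null (ae_iff.1 h)
  have hF : Measurable (N.indicator (1 : ℂ → ℝ≥0∞)) := measurable_one.indicator hNm
  have h0 := santalo_le _ hF
  rw [lintegral_indicator_one hNm, hN0, mul_zero, nonpos_iff_eq_zero] at h0
  have hmeas := (by fun_prop : Measurable fun p : ℝ × ℝ => ENNReal.ofReal (Real.cos p.2)).mul
    (measurable_lintegral_chord _ hF)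
  replace h0 := (lintegral_eq_zero_iff hmeas).1 h0
  filter_upwards [h0, ae_fan_cos_pos] with p hp hc
  have hc' := Real.cos_pos_of_mem_Ioo hc
  have hz : ∫⁻ t in Ioc 0 (exitTime p), N.indicator (1 : ℂ → ℝ≥0∞) (ray p t) = 0 := by
    rcases mul_eq_zero.1 hp with h | h
    · simp only [ENNReal.ofReal_eq_zero] at h; linarith
    · exact h
  have hmp : Measurable fun t => N.indicator (1 : ℂ → ℝ≥0∞) (ray p t) :=
    hF.comp (continuous_ray.comp (by fun_prop : Continuous fun t : ℝ => (p, t))).measurable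
  rw [lintegral_eq_zero_iff hmp] at hz
  filter_upwards [hz] with t ht
  by_contra hP
  have : ray p t ∈ N := hN hP
  simp [this] at ht

lemma xray_eq_of_cos_nonneg (f : ℂ → ℂ) (p : ℝ × ℝ) (hp : 0 ≤ exitTime p) :
    xray f p = ∫ t in Ioc 0 (exitTime p), f (ray p t) := by
  rw [xray, intervalIntegral.integral_of_le hp]

lemma ae_exitTime_pos : ∀ᵐ p ∂fanMeasure, 0 < exitTime p := by
  filter_upwards [ae_fan_cos_pos] with p hp
  exact mul_pos two_pos (Real.cos_pos_of_mem_Ioo hp)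

lemma aestronglyMeasurable_xray (f : ℂ → ℂ) (hf : StronglyMeasurable f) :
    AEStronglyMeasurable (xray f) fanMeasure := by
  have h1 : StronglyMeasurable ({q : (ℝ × ℝ) × ℝ | q.2 ∈ Ioc 0 (exitTime q.1)}.indicator
      fun q => f (ray q.1 q.2)) :=
    (hf.comp_measurable continuous_ray.measurable).indicator measurableSet_chord
  refine ⟨_, h1.integral_prod_right' (ν := volume), ?_⟩
  filter_upwards [ae_exitTime_pos] with p hp
  rw [xray_eq_of_cos_nonneg f p hp.le, ← integral_indicator measurableSet_Ioc]
  rfl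

lemma lintegral_sq_le (μ : Measure ℝ) (g : ℝ → ℂ) (hg : AEStronglyMeasurable g μ) :
    (∫⁻ t, ‖g t‖ₑ ∂μ) ^ 2 ≤ μ univ * ∫⁻ t, ‖g t‖ₑ ^ 2 ∂μ := by
  have h := ENNReal.lintegral_mul_le_Lp_mul_Lq μ Real.HolderConjugate.two_two
    (f := fun _ => 1) (g := fun t => ‖g t‖ₑ) aemeasurable_const hg.enorm
  simp only [Pi.mul_apply, one_mul, ENNReal.one_rpow, lintegral_one] at h
  calc _ ≤ _ := pow_le_pow_left' h 2
    _ = _ := by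
      rw [mul_pow, ← ENNReal.rpow_natCast, ← ENNReal.rpow_natCast, ← ENNReal.rpow_mul,
        ← ENNReal.rpow_mul]
      norm_num

lemma lintegral_xray_sq_le (f : ℂ → ℂ) (hf : StronglyMeasurable f) :
    ∫⁻ p, ‖xray f p‖ₑ ^ 2 ∂fanMeasure ≤
      ENNReal.ofReal (4 * Real.pi) * ∫⁻ z, ‖f z‖ₑ ^ 2 ∂diskMeasure := by
  have hm : Measurable fun z => ‖f z‖ₑ ^ 2 := by
    have := hf.enorm
    fun_prop
  calc ∫⁻ p, ‖xray f p‖ₑ ^ 2 ∂fanMeasure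
      ≤ ∫⁻ p, 2 * (ENNReal.ofReal (Real.cos p.2) *
        (∫⁻ t in Ioc 0 (exitTime p), ‖f (ray p t)‖ₑ ^ 2)) ∂fanMeasure := by
        refine lintegral_mono_ae ?_
        filter_upwards [ae_exitTime_pos] with p hp
        rw [xray_eq_of_cos_nonneg f p hp.le]
        have hgm : StronglyMeasurable fun t => f (ray p t) := hf.comp_measurable
          (continuous_ray.comp (by fun_prop : Continuous fun t : ℝ => (p, t))).measurable
        calc _ ≤ _ := pow_le_pow_left' (enorm_integral_le_lintegral_enorm _) 2
          _ ≤ _ := lintegral_sq_le _ _ hgm.aestronglyMeasurable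
          _ = _ := by
            rw [Measure.restrict_apply_univ, Real.volume_Ioc, sub_zero, exitTime,
              ENNReal.ofReal_mul zero_le_two, ENNReal.ofReal_ofNat, mul_assoc]
    _ = 2 * ∫⁻ p, ENNReal.ofReal (Real.cos p.2) *
        (∫⁻ t in Ioc 0 (exitTime p), ‖f (ray p t)‖ₑ ^ 2) ∂fanMeasure :=
        lintegral_const_mul' _ _ (by simp)
    _ ≤ 2 * (ENNReal.ofReal (2 * Real.pi) * ∫⁻ z, ‖f z‖ₑ ^ 2 ∂diskMeasure) := by
        gcongr; exact santalo_le _ hm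
    _ = _ := by
        rw [← mul_assoc, ← ENNReal.ofReal_ofNat, ← ENNReal.ofReal_mul zero_le_two]
        congr 2; ring

lemma eLpNorm_xray_le (f : ℂ → ℂ) (hf : StronglyMeasurable f) :
    eLpNorm (xray f) 2 fanMeasure ≤
      ENNReal.ofReal (Real.sqrt (4 * Real.pi)) * eLpNorm f 2 diskMeasure := by
  have h := lintegral_xray_sq_le f hf
  rw [eLpNorm_eq_lintegral_rpow_enorm_toReal two_ne_zero ENNReal.ofNat_ne_top,
    eLpNorm_eq_lintegral_rpow_enorm_toReal two_ne_zero ENNReal.ofNat_ne_top, Real.sqrt_eq_rpow,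
    ← ENNReal.ofReal_rpow_of_nonneg (by positivity) (by norm_num), ENNReal.toReal_ofNat,
    ← ENNReal.mul_rpow_of_nonneg _ _ (by norm_num)]
  simp only [ENNReal.rpow_two]
  gcongr

lemma memLp_xray (f : L2Disk) : MemLp (xray f) 2 fanMeasure := by
  refine ⟨aestronglyMeasurable_xray _ (Lp.stronglyMeasurable f), ?_⟩
  refine (eLpNorm_xray_le _ (Lp.stronglyMeasurable f)).trans_lt ?_
  exact ENNReal.mul_lt_top ENNReal.ofReal_lt_top (Lp.eLpNorm_lt_top f)

lemma ae_integrable_ray (f : L2Disk) :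
    ∀ᵐ p ∂fanMeasure, IntegrableOn (fun t => f (ray p t)) (Ioc 0 (exitTime p)) := by
  have hf := Lp.stronglyMeasurable f
  have hm : Measurable fun z => ‖f z‖ₑ ^ 2 := by
    have := hf.enorm
    fun_prop
  have hfin : ∫⁻ z, ‖f z‖ₑ ^ 2 ∂diskMeasure < ⊤ := by
    have := lintegral_rpow_enorm_lt_top_of_eLpNorm_lt_top two_ne_zero ENNReal.ofNat_ne_top
      (Lp.eLpNorm_lt_top f)
    simpa using this
  have hmeas := measurable_lintegral_chord _ hm
  have hlt := (santalo_le _ hm).trans_lt (ENNReal.mul_lt_top ENNReal.ofReal_lt_top hfin)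
  have hae := ae_lt_top ((by fun_prop : Measurable fun p : ℝ × ℝ =>
    ENNReal.ofReal (Real.cos p.2)).mul hmeas) hlt.ne
  filter_upwards [hae, ae_fan_cos_pos] with p hp hc
  have hc' := Real.cos_pos_of_mem_Ioo hc
  have hgm : StronglyMeasurable fun t => f (ray p t) := hf.comp_measurable
    (continuous_ray.comp (by fun_prop : Continuous fun t : ℝ => (p, t))).measurable
  have hI : ∫⁻ t in Ioc 0 (exitTime p), ‖f (ray p t)‖ₑ ^ 2 < ⊤ := by
    refine lt_top_iff_ne_top.2 fun h => ?_
    rw [Pi.mul_apply, h, ENNReal.mul_top (by simpa using hc')] at hp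
    exact lt_irrefl _ hp
  refine ⟨hgm.aestronglyMeasurable, ?_⟩
  have hsq := lintegral_sq_le (volume.restrict (Ioc 0 (exitTime p))) _ hgm.aestronglyMeasurable
  have : (∫⁻ t in Ioc 0 (exitTime p), ‖f (ray p t)‖ₑ) ^ 2 < ⊤ :=
    hsq.trans_lt (ENNReal.mul_lt_top (by simp) hI)
  exact (ENNReal.pow_lt_top_iff.1 this).resolve_right (by norm_num)

/-- The X-ray transform as a bounded operator `I₀ : L²(D) → L²(∂₊SD, dβ dα)`. -/
def I₀ : L2Disk →L[ℂ] L2Fan :=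
  LinearMap.mkContinuous
    { toFun := fun f => (memLp_xray f).toLp (xray f)
      map_add' := by
        intro f g
        rw [← MemLp.toLp_add, MemLp.toLp_eq_toLp_iff]
        filter_upwards [ae_ray (Lp.coeFn_add f g), ae_integrable_ray f, ae_integrable_ray g,
          ae_exitTime_pos] with p h hf hg hp
        simp only [Pi.add_apply, xray_eq_of_cos_nonneg _ p hp.le]
        rw [← integral_add hf hg]
        exact integral_congr_ae h
      map_smul' := by
        intro c f
        rw [RingHom.id_apply, ← MemLp.toLp_const_smul, MemLp.toLp_eq_toLp_iff]
        filter_upwards [ae_ray (Lp.coeFn_smul c f), ae_exitTime_pos] with p h hp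
        simp only [Pi.smul_apply, xray_eq_of_cos_nonneg _ p hp.le]
        rw [← integral_smul]
        exact integral_congr_ae h }
    (Real.sqrt (4 * Real.pi)) (by
      intro f
      change ‖(memLp_xray f).toLp (xray f)‖ ≤ _
      rw [Lp.norm_toLp, Lp.norm_def]
      have h := ENNReal.toReal_mono
        (ENNReal.mul_ne_top ENNReal.ofReal_ne_top (Lp.eLpNorm_lt_top f).ne)
        (eLpNorm_xray_le _ (Lp.stronglyMeasurable f))
      rwa [ENNReal.toReal_mul, ENNReal.toReal_ofReal (Real.sqrt_nonneg _)] at h)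

/-- The adjoint `I₀* : L²(∂₊SD, dβ dα) → L²(D)`. -/
def I₀Star : L2Fan →L[ℂ] L2Disk := ContinuousLinearMap.adjoint I₀

/-- The normal operator `I₀* I₀ : L²(D) → L²(D)`. -/
def normalOp : L2Disk →L[ℂ] L2Disk := I₀Star ∘L I₀

/-! ### The Zernike functions and the Zernike scale -/

/-- `ψ_{n,k}(β, α) = (-1)ⁿ/(4π) e^{i(n-2k)(β+α)} (e^{i(n+1)α} + (-1)ⁿ e^{-i(n+1)α})`. -/
def psiFun (n k : ℕ) (p : ℝ × ℝ) : ℂ :=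
  (-1) ^ n / (4 * Real.pi) * Complex.exp (Complex.I * (n - 2 * k) * (p.1 + p.2)) *
    (Complex.exp (Complex.I * (n + 1) * p.2) +
      (-1) ^ n * Complex.exp (-(Complex.I * (n + 1) * p.2)))

lemma memLp_psiFun (n k : ℕ) : MemLp (psiFun n k) 2 fanMeasure := by
  have hc : Continuous (psiFun n k) := by unfold psiFun; fun_prop
  refine MemLp.of_bound hc.aestronglyMeasurable (‖((-1) ^ n / (4 * Real.pi) : ℂ)‖ * 1 * (1 + 1))
    (Filter.Eventually.of_forall fun p => ?_)
  have e (r : ℂ) (x : ℝ) (hr : r = x * Complex.I) : ‖Complex.exp r‖ = 1 := by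
    rw [hr, Complex.norm_exp_ofReal_mul_I]
  have e1 : ‖Complex.exp (Complex.I * (n - 2 * k) * (p.1 + p.2))‖ = 1 :=
    e _ ((n - 2 * k) * (p.1 + p.2)) (by push_cast; ring)
  have e2 : ‖Complex.exp (Complex.I * (n + 1) * p.2)‖ = 1 :=
    e _ ((n + 1) * p.2) (by push_cast; ring)
  have e3 : ‖Complex.exp (-(Complex.I * (n + 1) * p.2))‖ = 1 :=
    e _ (-((n + 1) * p.2)) (by push_cast; ring)
  rw [psiFun, norm_mul, norm_mul, e1]
  gcongr
  refine (norm_add_le _ _).trans ?_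
  rw [norm_mul, e2, e3]
  simp

/-- `ψ_{n,k}` as an element of `L²(∂₊SD, dβ dα)`. -/
def psi (n k : ℕ) : L2Fan := (memLp_psiFun n k).toLp (psiFun n k)

/-- The Zernike functions `Z_{n,k} = I₀* ψ_{n,k}` (used for `0 ≤ k ≤ n`). -/
def zernike (n k : ℕ) : L2Disk := I₀Star (psi n k)

/-- The Zernike functions normalized in `L²(D)`. -/
def zernikeHat (n k : ℕ) : L2Disk := ((‖zernike n k‖⁻¹ : ℝ) : ℂ) • zernike n k

/-- The space `H̃ˢ(D)`, for `s ≥ 0`: the `f = ∑_{n ≥ 0} ∑_{0 ≤ k ≤ n} f_{n,k} Ẑ_{n,k}`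
with `∑_n (n+1)^{2s} ∑_k |f_{n,k}|² < ∞`. -/
def Htilde (s : ℝ) : Set L2Disk :=
  {f | ∃ c : (Σ n : ℕ, Fin (n + 1)) → ℂ,
    HasSum (fun i => c i • zernikeHat i.1 i.2) f ∧
    Summable (fun i => ((i.1 : ℝ) + 1) ^ (2 * s) * ‖c i‖ ^ 2)}

/-! ### The Sobolev space `H¹(D)` -/

/-- `g` is the weak derivative of `u` on the open unit disk in the direction `e`. -/
def IsWeakDeriv (e : ℂ) (u g : L2Disk) : Prop :=
  ∀ φ : ℂ → ℝ, ContDiff ℝ ∞ φ → HasCompactSupport φ → tsupport φ ⊆ Metric.ball (0 : ℂ) 1 →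
    ∫ z, (fderiv ℝ φ z e) • u z ∂diskMeasure = -∫ z, φ z • g z ∂diskMeasure

/-- `(gx, gy)` is the weak gradient of `u`. -/
def IsWeakGradient (u gx gy : L2Disk) : Prop :=
  IsWeakDeriv 1 u gx ∧ IsWeakDeriv Complex.I u gy

/-- The Sobolev space `H¹(D)`: the `u ∈ L²(D)` whose weak gradient is in `L²(D)`. -/
def H1 : Set L2Disk := {u | ∃ gx gy, IsWeakGradient u gx gy}

/-- The operator `A` on `L²(D)` is bounded from `L²(D)` to `H¹(D)`: it maps `L²(D)` into `H¹(D)`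
and `‖A f‖_{H¹} ≤ C ‖f‖_{L²}`, where `‖u‖²_{H¹} = ‖u‖²_{L²} + ‖∇u‖²_{L²}`. -/
def IsBoundedL2H1 (A : L2Disk → L2Disk) : Prop :=
  ∃ C : ℝ, 0 ≤ C ∧ ∀ f : L2Disk, ∃ gx gy, IsWeakGradient (A f) gx gy ∧
    Real.sqrt (‖A f‖ ^ 2 + ‖gx‖ ^ 2 + ‖gy‖ ^ 2) ≤ C * ‖f‖

end DiskXRay

end

noncomputable section

namespace DiskXRay

open Filter Topology Polynomial
open Polynomial.Chebyshev (U T)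

/-! ### Superpositions of ridge polynomials -/

/-! The proof diagonalizes the normal operator. Up to the factor `cos α`, which is exactly the
weight in Santaló's formula, `ψ_{n,k}` is a function of the line alone: an exponential in `b = β +
α` times the Chebyshev polynomial `U_n` of `s = sin α`. Hence `Z_{n,k}` is the superposition over
`b` of the ridge polynomials `U_n(s(b, z))` (`zernike_eq_contL2`), a polynomial of degree at most
`n`. Since `U_n` is a derivative of `T_{n+1} / (n+1)`, its chord integrals factor
(`integral_U_ridge`), and `I₀ Z_{n,k} = 4π/(n+1) ψ_{n,k}` follows (`I₀_zernike`). The `Z_{n,k}` are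
therefore eigenfunctions with eigenvalue `4π/(n+1)`; they are orthogonal, and a dimension count with
Stone-Weierstrass makes them complete (`zernikeBasis`). The description of the range is then a
statement about coefficients (`range_normalOp`).

The inclusion of `H1` rests on the degenerate elliptic equation `-div(∇Z - x(x·∇Z)) = n(n+2) Z`
(`div_flux`). The flux is tangent to the boundary circle, so Green's formula holds against every
function of `H1` without a boundary term (`IsWeakGradient.inner_flux`). A Bessel inequality for the
energy form then bounds `∑ n(n+2)|u_{n,k}|²` by `‖∇u‖²`, and `n(n+2) + 1 = (n+1)²`.

For the radial functions, `(∂ₓ - i∂_y) Z_{2m,m}` satisfies a two-term recursion whose increments are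
orthogonal Zernike functions. This gives a gradient of squared norm at least `2π m(m+1)`. After
multiplication by the eigenvalue it stays bounded below, while `‖Z_{2m,m}‖² = π/(2m+1)` tends to
zero, so no norm inequality can hold. Strictness of the inclusion is a consequence: equality would
put the range of the normal operator inside `H1`, and the closed graph theorem would make the
operator bounded. -/

/-- The signed distance to the origin of the line through `z` with direction `e^{ib}`, up to
sign. -/
def lineCoord (b : ℝ) (z : ℂ) : ℝ := z.re * Real.sin b - z.im * Real.cos b

lemma continuous_lineCoord : Continuous fun q : ℂ × ℝ => lineCoord q.2 q.1 := by
  unfold lineCoord; fun_prop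

/-- The superposition `z ↦ ∫ w(b) p(s(b, z)) db` of ridge polynomials. -/
def ridgeFun (w : C(ℝ, ℂ)) (p : ℂ[X]) (z : ℂ) : ℂ :=
  ∫ b in (0 : ℝ)..(2 * Real.pi), w b * p.eval (lineCoord b z : ℂ)

lemma continuous_ridge_integrand (w : C(ℝ, ℂ)) (p : ℂ[X]) :
    Continuous fun q : ℂ × ℝ => w q.2 * p.eval (lineCoord q.2 q.1 : ℂ) := by
  have := continuous_lineCoord
  exact (w.continuous.comp continuous_snd).mul
    (p.continuous.comp (Complex.continuous_ofReal.comp this))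

lemma intervalIntegrable_ridge (w : C(ℝ, ℂ)) (p : ℂ[X]) (z : ℂ) (a b : ℝ) :
    IntervalIntegrable (fun b => w b * p.eval (lineCoord b z : ℂ)) volume a b :=
  ((continuous_ridge_integrand w p).comp (by fun_prop : Continuous fun b : ℝ => (z, b))
    ).intervalIntegrable _ _

lemma ridgeFun_add_right (w : C(ℝ, ℂ)) (p q : ℂ[X]) (z : ℂ) :
    ridgeFun w (p + q) z = ridgeFun w p z + ridgeFun w q z := by
  unfold ridgeFun
  rw [← intervalIntegral.integral_add (intervalIntegrable_ridge w p z _ _)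
    (intervalIntegrable_ridge w q z _ _)]
  simp only [eval_add, mul_add]

lemma ridgeFun_C_mul_right (w : C(ℝ, ℂ)) (c : ℂ) (p : ℂ[X]) (z : ℂ) :
    ridgeFun w (C c * p) z = c * ridgeFun w p z := by
  unfold ridgeFun
  rw [← intervalIntegral.integral_const_mul]
  congr 1 with b
  rw [eval_mul, eval_C]; ring

lemma ridgeFun_add_left (v w : C(ℝ, ℂ)) (p : ℂ[X]) (z : ℂ) :
    ridgeFun (v + w) p z = ridgeFun v p z + ridgeFun w p z := by
  unfold ridgeFun
  rw [← intervalIntegral.integral_add (intervalIntegrable_ridge v p z _ _)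
    (intervalIntegrable_ridge w p z _ _)]
  simp only [ContinuousMap.add_apply, add_mul]

lemma ridgeFun_smul_left (c : ℂ) (w : C(ℝ, ℂ)) (p : ℂ[X]) (z : ℂ) :
    ridgeFun (c • w) p z = c * ridgeFun w p z := by
  unfold ridgeFun
  rw [← intervalIntegral.integral_const_mul]
  congr 1 with b
  simp only [ContinuousMap.smul_apply, smul_eq_mul, mul_assoc]

/-- Binomial expansion of `(x sin b - y cos b)^j`: the coefficients are trigonometric moments of
`w`. -/
lemma ridgeFun_X_pow (w : C(ℝ, ℂ)) (j : ℕ) : ∃ c : ℕ → ℂ, ∀ z : ℂ,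
    ridgeFun w (X ^ j) z = ∑ l ∈ Finset.range (j + 1), c l * (z.re ^ l * z.im ^ (j - l)) := by
  refine ⟨fun l => ∫ b in (0 : ℝ)..(2 * Real.pi), w b * ((Real.sin b : ℂ) ^ l *
    (-(Real.cos b : ℂ)) ^ (j - l) * (j.choose l)), fun z => ?_⟩
  simp_rw [← intervalIntegral.integral_mul_const]
  rw [← intervalIntegral.integral_finsetSum]
  · unfold ridgeFun
    congr 1 with b
    rw [eval_pow, eval_X, lineCoord, sub_eq_add_neg, ← mul_neg]
    push_cast
    rw [add_pow, Finset.mul_sum]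
    refine Finset.sum_congr rfl fun l _ => ?_
    rw [mul_pow, mul_pow]; ring
  · intro l _
    apply Continuous.intervalIntegrable
    fun_prop

lemma ridgeFun_sum_right (w : C(ℝ, ℂ)) (s : Finset ℕ) (f : ℕ → ℂ[X]) (z : ℂ) :
    ridgeFun w (∑ j ∈ s, f j) z = ∑ j ∈ s, ridgeFun w (f j) z := by
  classical
  induction s using Finset.induction_on with
  | empty => simp [ridgeFun]
  | insert a s ha ih => rw [Finset.sum_insert ha, Finset.sum_insert ha, ridgeFun_add_right, ih]

/-- A superposition of ridge polynomials of degree at most `N` is a polynomial in the real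
coordinates, of degree at most `N`. -/
lemma ridgeFun_eq_sum (w : C(ℝ, ℂ)) (p : ℂ[X]) (N : ℕ) (hp : p.natDegree ≤ N) :
    ∃ c : ℕ → ℕ → ℂ, ∀ z : ℂ, ridgeFun w p z =
      ∑ j ∈ Finset.range (N + 1), ∑ l ∈ Finset.range (j + 1),
        c j l * (z.re ^ l * z.im ^ (j - l)) := by
  choose c hc using fun j => ridgeFun_X_pow w j
  refine ⟨fun j l => p.coeff j * c j l, fun z => ?_⟩
  conv_lhs => rw [p.as_sum_range_C_mul_X_pow' (Nat.lt_succ_of_le hp)]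
  rw [ridgeFun_sum_right]
  refine Finset.sum_congr rfl fun j _ => ?_
  rw [ridgeFun_C_mul_right, hc, Finset.mul_sum]
  exact Finset.sum_congr rfl fun l _ => by ring

lemma contDiff_re : ContDiff ℝ ∞ fun z : ℂ => (z.re : ℂ) :=
  (Complex.ofRealCLM.comp Complex.reCLM).contDiff

lemma contDiff_im : ContDiff ℝ ∞ fun z : ℂ => (z.im : ℂ) :=
  (Complex.ofRealCLM.comp Complex.imCLM).contDiff

lemma contDiff_ridgeFun (w : C(ℝ, ℂ)) (p : ℂ[X]) : ContDiff ℝ ∞ (ridgeFun w p) := by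
  obtain ⟨c, hc⟩ := ridgeFun_eq_sum w p _ le_rfl
  rw [funext hc]
  refine ContDiff.sum fun j _ => ContDiff.sum fun l _ => contDiff_const.mul ?_
  exact (contDiff_re.pow _).mul (contDiff_im.pow _)

lemma continuous_ridgeFun (w : C(ℝ, ℂ)) (p : ℂ[X]) : Continuous (ridgeFun w p) :=
  (contDiff_ridgeFun w p).continuous

/-- `sin` as a complex-valued continuous function on `ℝ`. -/
def sinC : C(ℝ, ℂ) := ⟨fun b => (Real.sin b : ℂ), by fun_prop⟩

/-- `cos` as a complex-valued continuous function on `ℝ`. -/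
def cosC : C(ℝ, ℂ) := ⟨fun b => (Real.cos b : ℂ), by fun_prop⟩

lemma sinC_apply (b : ℝ) : sinC b = (Real.sin b : ℂ) := rfl

lemma cosC_apply (b : ℝ) : cosC b = (Real.cos b : ℂ) := rfl

/-- The ridge coordinate is linear, so `p(s(b, z))` has derivative `p'(s(b, z)) s(b, e)` along `e`,
and differentiation only changes the weight by `sin` or `cos`. Smoothness is already known from the
polynomial form, so it is enough to differentiate under the integral along the line `t ↦ z + t e`.
-/
lemma fderiv_ridgeFun (w : C(ℝ, ℂ)) (p : ℂ[X]) (z e : ℂ) :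
    fderiv ℝ (ridgeFun w p) z e =
      e.re * ridgeFun (w * sinC) p.derivative z - e.im * ridgeFun (w * cosC) p.derivative z := by
  have hlin (b t : ℝ) : lineCoord b (z + t • e) = lineCoord b z + t * lineCoord b e := by
    simp only [lineCoord, Complex.add_re, Complex.add_im, Complex.smul_re, Complex.smul_im,
      smul_eq_mul]
    ring
  set F : ℝ → ℝ → ℂ := fun t b => w b * p.eval (lineCoord b (z + t • e) : ℂ) with hF
  set F' : ℝ → ℝ → ℂ := fun t b =>
    w b * (p.derivative.eval (lineCoord b (z + t • e) : ℂ) * lineCoord b e) with hF'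
  have hcF (t : ℝ) : Continuous (F t) := (continuous_ridge_integrand w p).comp
    (by fun_prop : Continuous fun b : ℝ => (z + t • e, b))
  have hcF' : Continuous fun q : ℝ × ℝ => F' q.1 q.2 := by
    have h1 := (continuous_ridge_integrand w p.derivative).comp
      (by fun_prop : Continuous fun q : ℝ × ℝ => (z + q.1 • e, q.2))
    have h2 : Continuous fun q : ℝ × ℝ => (lineCoord q.2 e : ℂ) := by
      unfold lineCoord; fun_prop
    refine (h1.mul h2).congr fun q => ?_
    simp only [hF', Pi.mul_apply, Function.comp_apply]; ring
  -- Dominating constant for the derivative, uniform for `|t| ≤ 1` and `b` in a period.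
  obtain ⟨M, hM⟩ := ((isCompact_closedBall (0 : ℝ) 1).prod
    (isCompact_Icc (a := (0 : ℝ)) (b := 2 * Real.pi))).exists_bound_of_continuousOn
    hcF'.continuousOn
  have hd (t b : ℝ) : HasDerivAt (fun t => F t b) (F' t b) t := by
    have h1 : HasDerivAt (fun t : ℝ => ((lineCoord b z + t * lineCoord b e : ℝ) : ℂ))
        (lineCoord b e : ℂ) t := by
      have := (((hasDerivAt_id t).mul_const (lineCoord b e)).const_add
        (lineCoord b z)).ofReal_comp
      simpa using this
    have h2 := (p.hasDerivAt ((lineCoord b z + t * lineCoord b e : ℝ) : ℂ)).comp t h1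
    simp only [hF, hF', hlin]
    exact h2.const_mul (w b)
  have hder : HasDerivAt (fun t => ∫ b in (0 : ℝ)..(2 * Real.pi), F t b)
      (∫ b in (0 : ℝ)..(2 * Real.pi), F' 0 b) 0 := by
    refine (intervalIntegral.hasDerivAt_integral_of_dominated_loc_of_deriv_le
      (bound := fun _ => M) (s := Metric.ball 0 1) (Metric.ball_mem_nhds _ one_pos) ?_ ?_ ?_ ?_
      intervalIntegrable_const ?_).2
    · exact Filter.Eventually.of_forall fun t => (hcF t).aestronglyMeasurable
    · exact (hcF 0).intervalIntegrable _ _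
    · exact (hcF'.comp (by fun_prop : Continuous fun b : ℝ => ((0 : ℝ), b))).aestronglyMeasurable
    · refine Filter.Eventually.of_forall fun b hb t ht =>
        hM (t, b) ⟨Metric.ball_subset_closedBall ht, ?_⟩
      rw [uIoc_of_le Real.two_pi_pos.le] at hb
      exact Ioc_subset_Icc_self hb
    · exact Filter.Eventually.of_forall fun b _ t _ => hd t b
  have hz : HasDerivAt (fun t : ℝ => z + t • e) e 0 := by
    simpa using ((hasDerivAt_id (0 : ℝ)).smul_const e).const_add z
  have hf : HasFDerivAt (ridgeFun w p) (fderiv ℝ (ridgeFun w p) z) (z + (0 : ℝ) • e) := by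
    rw [zero_smul, add_zero]
    exact ((contDiff_ridgeFun w p).differentiable (by simp)).differentiableAt.hasFDerivAt
  have hcomp : HasDerivAt (ridgeFun w p ∘ fun t : ℝ => z + t • e)
      (fderiv ℝ (ridgeFun w p) z e) 0 := hf.comp_hasDerivAt (0 : ℝ) hz
  rw [hcomp.unique (show HasDerivAt (ridgeFun w p ∘ fun t : ℝ => z + t • e) _ 0 from hder)]
  unfold ridgeFun
  rw [← intervalIntegral.integral_const_mul, ← intervalIntegral.integral_const_mul,
    ← intervalIntegral.integral_sub]
  · congr 1 with b
    simp only [hF', zero_smul, add_zero, ContinuousMap.mul_apply, sinC_apply, cosC_apply]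
    rw [show (lineCoord b e : ℂ) = e.re * Real.sin b - e.im * Real.cos b by
      simp [lineCoord]]
    ring
  · exact (intervalIntegrable_ridge (w * sinC) _ z _ _).const_mul _
  · exact (intervalIntegrable_ridge (w * cosC) _ z _ _).const_mul _

/-- Under the integral `x sin b - y cos b` is the ridge variable itself. With a derivative in place
of `p`, this computes the action of the Euler field `x ∂ₓ + y ∂_y`. -/
lemma ridgeFun_euler (w : C(ℝ, ℂ)) (p : ℂ[X]) (z : ℂ) :
    z.re * ridgeFun (w * sinC) p z - z.im * ridgeFun (w * cosC) p z = ridgeFun w (X * p) z := by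
  unfold ridgeFun
  rw [← intervalIntegral.integral_const_mul, ← intervalIntegral.integral_const_mul,
    ← intervalIntegral.integral_sub]
  · congr 1 with b
    simp only [ContinuousMap.mul_apply, sinC_apply, cosC_apply, eval_mul, eval_X]
    rw [show (lineCoord b z : ℂ) = z.re * Real.sin b - z.im * Real.cos b by
      simp [lineCoord]]
    ring
  · exact (intervalIntegrable_ridge (w * sinC) _ z _ _).const_mul _
  · exact (intervalIntegrable_ridge (w * cosC) _ z _ _).const_mul _

/-! ### Continuous functions in `L²(D)` -/

lemma ae_disk_mem_closedBall : ∀ᵐ z ∂diskMeasure, z ∈ Metric.closedBall (0 : ℂ) 1 :=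
  ae_restrict_mem Metric.isClosed_closedBall.measurableSet

lemma ae_disk_mem_ball : ∀ᵐ z ∂diskMeasure, z ∈ Metric.ball (0 : ℂ) 1 := by
  have h : ∀ᵐ z ∂diskMeasure, z ∉ Metric.sphere (0 : ℂ) 1 := by
    refine ae_restrict_of_ae ?_
    exact measure_eq_zero_iff_ae_notMem.1 (Measure.addHaar_sphere volume (0 : ℂ) 1)
  filter_upwards [h, ae_disk_mem_closedBall] with z h1 h2
  rw [mem_sphere_zero_iff_norm] at h1
  rw [mem_closedBall_zero_iff] at h2
  rw [mem_ball_zero_iff]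
  exact lt_of_le_of_ne h2 h1

lemma exists_disk_bound (f : ℂ → ℂ) (hf : Continuous f) :
    ∃ C, ∀ᵐ z ∂diskMeasure, ‖f z‖ ≤ C := by
  obtain ⟨C, hC⟩ := (isCompact_closedBall (0 : ℂ) 1).exists_bound_of_continuousOn hf.continuousOn
  exact ⟨C, by filter_upwards [ae_disk_mem_closedBall] with z hz using hC z hz⟩

lemma memLp_disk (f : ℂ → ℂ) (hf : Continuous f) : MemLp f 2 diskMeasure := by
  obtain ⟨C, hC⟩ := exists_disk_bound f hf
  exact MemLp.of_bound hf.aestronglyMeasurable C hC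

/-- The class in `L²(D)` of a continuous function on the plane. -/
def contL2 : C(ℂ, ℂ) →ₗ[ℂ] L2Disk where
  toFun f := (memLp_disk f f.continuous).toLp f
  map_add' _ _ := MemLp.toLp_add _ _
  map_smul' c _ := MemLp.toLp_const_smul c _

lemma coeFn_contL2 (f : C(ℂ, ℂ)) : contL2 f =ᵐ[diskMeasure] f :=
  MemLp.coeFn_toLp (memLp_disk f f.continuous)

lemma inner_contL2_left (f : C(ℂ, ℂ)) (g : L2Disk) :
    inner ℂ (contL2 f) g = ∫ z, starRingEnd ℂ (f z) * g z ∂diskMeasure := by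
  rw [L2.inner_def]
  refine integral_congr_ae ?_
  filter_upwards [coeFn_contL2 f] with z hz
  rw [hz, RCLike.inner_apply, mul_comm]

lemma integrable_L2Disk (g : L2Disk) : Integrable g diskMeasure :=
  (Lp.memLp g).integrable one_le_two

lemma integrable_mul_L2Disk (f : ℂ → ℂ) (hf : Continuous f) (g : L2Disk) :
    Integrable (fun z => f z * g z) diskMeasure := by
  obtain ⟨C, hC⟩ := exists_disk_bound f hf
  exact (integrable_L2Disk g).bdd_mul hf.aestronglyMeasurable hC

/-! ### Weak derivatives -/

lemma continuous_fderiv_apply {F : Type*} [NormedAddCommGroup F] [NormedSpace ℝ F]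
    {f : ℂ → F} (hf : ContDiff ℝ ∞ f) (e : ℂ) : Continuous fun z => fderiv ℝ f z e :=
  (hf.continuous_fderiv (by simp)).clm_apply continuous_const

lemma differentiable_of_smooth {F : Type*} [NormedAddCommGroup F] [NormedSpace ℝ F]
    {f : ℂ → F} (hf : ContDiff ℝ ∞ f) : Differentiable ℝ f := hf.differentiable (by simp)

/-- Weak derivatives may be tested on complex-valued test functions. -/
lemma IsWeakDeriv.integral_complex {e : ℂ} {u g : L2Disk} (h : IsWeakDeriv e u g) (φ : ℂ → ℂ)
    (hφ : ContDiff ℝ ∞ φ) (hc : HasCompactSupport φ)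
    (hs : tsupport φ ⊆ Metric.ball (0 : ℂ) 1) :
    ∫ z, fderiv ℝ φ z e * u z ∂diskMeasure = -∫ z, φ z * g z ∂diskMeasure := by
  -- The definition tests only with real functions; it is applied to the real and imaginary parts of
  -- `φ`.
  have key (L : ℂ →L[ℝ] ℝ) :
      ∫ z, ((L (fderiv ℝ φ z e) : ℝ) : ℂ) * u z ∂diskMeasure =
        -∫ z, ((L (φ z) : ℝ) : ℂ) * g z ∂diskMeasure := by
    have hL : ContDiff ℝ ∞ (fun z => L (φ z)) := L.contDiff.comp hφ
    have hsub : Function.support (fun z => L (φ z)) ⊆ Function.support φ := by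
      intro z hz h0
      exact hz (by simp only [h0, map_zero])
    have := h (fun z => L (φ z)) hL (hc.mono hsub) ((closure_mono hsub).trans hs)
    have hd (z : ℂ) : fderiv ℝ (fun z => L (φ z)) z e = L (fderiv ℝ φ z e) := by
      have := (L.hasFDerivAt (x := φ z)).comp z (differentiable_of_smooth hφ z).hasFDerivAt
      rw [show (fun z => L (φ z)) = L ∘ φ from rfl, this.fderiv]
      rfl
    simpa only [hd, Complex.real_smul] using this
  have h1 := (key Complex.reCLM)
  have h2 := (key Complex.imCLM)
  simp only [Complex.reCLM_apply, Complex.imCLM_apply] at h1 h2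
  have hci (L : ℂ →L[ℝ] ℝ) (f : ℂ → ℂ) (hf : Continuous f) (v : L2Disk) :
      Integrable (fun z => ((L (f z) : ℝ) : ℂ) * v z) diskMeasure :=
    integrable_mul_L2Disk _ (by fun_prop) v
  have split (f : ℂ → ℂ) (hf : Continuous f) (v : L2Disk) : ∫ z, f z * v z ∂diskMeasure =
      ∫ z, ((f z).re : ℂ) * v z ∂diskMeasure + Complex.I * ∫ z, ((f z).im : ℂ) * v z ∂diskMeasure
      := by
    have i₁ : Integrable (fun z => ((f z).re : ℂ) * v z) diskMeasure := hci Complex.reCLM f hf v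
    have i₂ : Integrable (fun z => ((f z).im : ℂ) * v z) diskMeasure := hci Complex.imCLM f hf v
    rw [← integral_const_mul, ← integral_add i₁ (i₂.const_mul _)]
    congr 1 with z
    conv_lhs => rw [← Complex.re_add_im (f z)]
    ring
  rw [split _ (continuous_fderiv_apply hφ e), split _ hφ.continuous, h1, h2]
  ring

/-! ### Radial cutoffs and integration by parts up to the boundary -/

/-- A smooth cutoff of the half-line: `0` on `(-∞, 1]` and `1` on `[2, ∞)`. -/
def cutoffProfile (t : ℝ) : ℝ := Real.smoothTransition (t - 1)

lemma contDiff_cutoffProfile : ContDiff ℝ ∞ cutoffProfile :=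
  Real.smoothTransition.contDiff.comp (contDiff_id.sub contDiff_const)

lemma cutoffProfile_eq_zero {t : ℝ} (h : t ≤ 1) : cutoffProfile t = 0 :=
  Real.smoothTransition.zero_of_nonpos (by linarith)

lemma cutoffProfile_eq_one {t : ℝ} (h : 2 ≤ t) : cutoffProfile t = 1 :=
  Real.smoothTransition.one_of_one_le (by linarith)

lemma norm_cutoffProfile_le (t : ℝ) : ‖cutoffProfile t‖ ≤ 1 := by
  rw [cutoffProfile, Real.norm_eq_abs, abs_of_nonneg (Real.smoothTransition.nonneg _)]
  exact Real.smoothTransition.le_one _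

lemma deriv_cutoffProfile_of_lt {t : ℝ} (h : t < 1) : deriv cutoffProfile t = 0 := by
  have : cutoffProfile =ᶠ[𝓝 t] fun _ => 0 := by
    filter_upwards [Iio_mem_nhds h] with s hs using cutoffProfile_eq_zero (le_of_lt hs)
  rw [this.deriv_eq, deriv_const]

lemma deriv_cutoffProfile_of_gt {t : ℝ} (h : 2 < t) : deriv cutoffProfile t = 0 := by
  have : cutoffProfile =ᶠ[𝓝 t] fun _ => 1 := by
    filter_upwards [Ioi_mem_nhds h] with s hs using cutoffProfile_eq_one (le_of_lt hs)
  rw [this.deriv_eq, deriv_const]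

/-- The gradient of `diskCutoff k` is of order `k` in a boundary layer of width of order `1/k`.
Against a field whose normal component is `O(1 - |z|²)`, only `t * deriv cutoffProfile t` remains,
with `t = k (1 - |z|²)`, and this is bounded independently of `k`. -/
lemma exists_bound_mul_deriv_cutoffProfile :
    ∃ M, ∀ t : ℝ, ‖t * deriv cutoffProfile t‖ ≤ M := by
  have hc : Continuous fun t : ℝ => t * deriv cutoffProfile t :=
    continuous_id.mul (contDiff_cutoffProfile.continuous_deriv (by simp))
  obtain ⟨M, hM⟩ := (isCompact_Icc (a := (1 : ℝ)) (b := 2)).exists_bound_of_continuousOn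
    hc.continuousOn
  refine ⟨max M 0, fun t => ?_⟩
  by_cases h1 : t < 1
  · simp [deriv_cutoffProfile_of_lt h1]
  by_cases h2 : 2 < t
  · simp [deriv_cutoffProfile_of_gt h2]
  · exact (hM t ⟨not_lt.1 h1, not_lt.1 h2⟩).trans (le_max_left _ _)

/-- Radial smooth cutoffs, compactly supported in the open disk. -/
def diskCutoff (k : ℝ) (z : ℂ) : ℝ := cutoffProfile (k * (1 - (z.re ^ 2 + z.im ^ 2)))

lemma sq_norm_eq (z : ℂ) : ‖z‖ ^ 2 = z.re ^ 2 + z.im ^ 2 := by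
  rw [Complex.sq_norm, Complex.normSq_apply]; ring

lemma hasFDerivAt_radial (k : ℝ) (z : ℂ) :
    HasFDerivAt (fun z : ℂ => k * (1 - (z.re ^ 2 + z.im ^ 2)))
      ((-2 * k * z.re) • Complex.reCLM + (-2 * k * z.im) • Complex.imCLM) z := by
  have h1 := (Complex.reCLM.hasFDerivAt (x := z)).pow 2
  have h2 := (Complex.imCLM.hasFDerivAt (x := z)).pow 2
  refine (((h1.add h2).const_sub 1).const_mul k).congr_fderiv ?_
  ext v
  simp
  ring

lemma contDiff_diskCutoff (k : ℝ) : ContDiff ℝ ∞ (diskCutoff k) := by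
  refine contDiff_cutoffProfile.comp (contDiff_const.mul (contDiff_const.sub ?_))
  exact (Complex.reCLM.contDiff.pow 2).add (Complex.imCLM.contDiff.pow 2)

lemma fderiv_diskCutoff (k : ℝ) (z e : ℂ) : fderiv ℝ (diskCutoff k) z e =
    -2 * k * deriv cutoffProfile (k * (1 - (z.re ^ 2 + z.im ^ 2))) *
      (z.re * e.re + z.im * e.im) := by
  have h1 : HasDerivAt cutoffProfile _ (k * (1 - (z.re ^ 2 + z.im ^ 2))) :=
    ((contDiff_cutoffProfile.differentiable (by simp)) _).hasDerivAt
  have h2 : HasFDerivAt (diskCutoff k) _ z := h1.comp_hasFDerivAt z (hasFDerivAt_radial k z)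
  rw [h2.fderiv]
  simp
  ring

lemma tsupport_diskCutoff_subset (k : ℝ) :
    tsupport (diskCutoff k) ⊆ {z : ℂ | k * (‖z‖ ^ 2 - 1) ≤ -1} := by
  refine closure_minimal ?_ (isClosed_le (by fun_prop) continuous_const)
  intro z hz
  by_contra h
  rw [mem_ofPred_eq, not_le, sq_norm_eq] at h
  exact hz (cutoffProfile_eq_zero (by linarith))

lemma tsupport_diskCutoff_subset_ball {k : ℝ} (hk : 0 < k) :
    tsupport (diskCutoff k) ⊆ Metric.ball 0 1 := by
  refine (tsupport_diskCutoff_subset k).trans fun z hz => ?_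
  rw [mem_ofPred_eq] at hz
  rw [mem_ball_zero_iff]
  by_contra! h
  nlinarith [mul_nonneg hk.le (by nlinarith : 0 ≤ ‖z‖ ^ 2 - 1)]

lemma hasCompactSupport_diskCutoff {k : ℝ} (hk : 0 < k) : HasCompactSupport (diskCutoff k) :=
  (isCompact_closedBall (0 : ℂ) 1).of_isClosed_subset (isClosed_tsupport _)
    ((tsupport_diskCutoff_subset_ball hk).trans Metric.ball_subset_closedBall)

/-- Integration by parts up to the boundary, for smooth vector fields whose normal component
vanishes there. -/
lemma IsWeakGradient.integral_eq_of_tangent {u gx gy : L2Disk} (h : IsWeakGradient u gx gy)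
    (F₁ F₂ g : ℂ → ℂ) (h₁ : ContDiff ℝ ∞ F₁) (h₂ : ContDiff ℝ ∞ F₂) (hg : Continuous g)
    (hr : ∀ z : ℂ, z.re * F₁ z + z.im * F₂ z = (1 - (z.re ^ 2 + z.im ^ 2)) * g z) :
    ∫ z, F₁ z * gx z ∂diskMeasure + ∫ z, F₂ z * gy z ∂diskMeasure =
      -∫ z, (fderiv ℝ F₁ z 1 + fderiv ℝ F₂ z Complex.I) * u z ∂diskMeasure := by
  set R : ℕ → ℂ → ℝ := fun k z => ((k : ℝ) + 1) * (1 - (z.re ^ 2 + z.im ^ 2)) with hR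
  set χ : ℕ → ℂ → ℝ := fun k => diskCutoff ((k : ℝ) + 1) with hχ
  have hk (k : ℕ) : (0 : ℝ) < (k : ℝ) + 1 := by positivity
  have hsm (k : ℕ) {F : ℂ → ℂ} (hF : ContDiff ℝ ∞ F) :
      ContDiff ℝ ∞ fun z => (χ k z : ℂ) * F z :=
    (Complex.ofRealCLM.contDiff.comp (contDiff_diskCutoff _)).mul hF
  have hsub (k : ℕ) (F : ℂ → ℂ) :
      Function.support (fun z => (χ k z : ℂ) * F z) ⊆ Function.support (χ k) := by
    intro z hz h0
    exact hz (by simp [h0])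
  have hder (k : ℕ) {F : ℂ → ℂ} (hF : ContDiff ℝ ∞ F) (z e : ℂ) :
      fderiv ℝ (fun z => (χ k z : ℂ) * F z) z e =
        (χ k z : ℂ) * fderiv ℝ F z e + ((-2 * ((k : ℝ) + 1) * deriv cutoffProfile (R k z) *
          (z.re * e.re + z.im * e.im) : ℝ) : ℂ) * F z := by
    have e1 : HasFDerivAt (fun z => (χ k z : ℂ))
        (Complex.ofRealCLM.comp (fderiv ℝ (χ k) z)) z :=
      Complex.ofRealCLM.hasFDerivAt.comp z
        ((differentiable_of_smooth (contDiff_diskCutoff _)) z).hasFDerivAt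
    have e2 := e1.mul (differentiable_of_smooth hF z).hasFDerivAt
    rw [show (fun z => (χ k z : ℂ) * F z) = (fun z => (χ k z : ℂ)) * F from rfl, e2.fderiv,
      ← fderiv_diskCutoff]
    simp [hχ]
    ring
  have htest (k : ℕ) {F : ℂ → ℂ} (hF : ContDiff ℝ ∞ F) {e : ℂ} {v : L2Disk}
      (hv : IsWeakDeriv e u v) := hv.integral_complex _ (hsm k hF)
    ((hasCompactSupport_diskCutoff (hk k)).mono (hsub k F))
    ((closure_mono (hsub k F)).trans (tsupport_diskCutoff_subset_ball (hk k)))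
  -- Test with `χ k * F₁` and `χ k * F₂`. By `hr`, the radial derivative of the cutoff meets `(1 -
  -- |z|²) g`, which absorbs the factor `k + 1` into `R k`.
  have hid (k : ℕ) : ∫ z, ((χ k z : ℂ) * (fderiv ℝ F₁ z 1 + fderiv ℝ F₂ z Complex.I) +
        ((-2 * (R k z * deriv cutoffProfile (R k z)) : ℝ) : ℂ) * g z) * u z ∂diskMeasure =
      -(∫ z, (χ k z : ℂ) * F₁ z * gx z ∂diskMeasure +
        ∫ z, (χ k z : ℂ) * F₂ z * gy z ∂diskMeasure) := by
    rw [neg_add, ← htest k h₁ h.1, ← htest k h₂ h.2, ← integral_add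
      (integrable_mul_L2Disk _ (continuous_fderiv_apply (hsm k h₁) _) u)
      (integrable_mul_L2Disk _ (continuous_fderiv_apply (hsm k h₂) _) u)]
    congr 1 with z
    rw [hder k h₁, hder k h₂]
    have := hr z
    simp only [Complex.one_re, Complex.one_im, Complex.I_re, Complex.I_im, hR]
    push_cast
    linear_combination (2 * ((k : ℂ) + 1) *
      ((deriv cutoffProfile (((k : ℝ) + 1) * (1 - (z.re ^ 2 + z.im ^ 2))) : ℝ) : ℂ) * u z) * this
  -- At each interior point the cutoff is eventually constant equal to `1`; this yields both
  -- pointwise limits below.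
  have hχ1 (z : ℂ) (hz : z ∈ Metric.ball (0 : ℂ) 1) : ∀ᶠ k : ℕ in atTop, 2 < R k z := by
    have hz' : 0 < 1 - (z.re ^ 2 + z.im ^ 2) := by
      rw [mem_ball_zero_iff] at hz
      rw [← sq_norm_eq]
      nlinarith [norm_nonneg z]
    have : Tendsto (fun k : ℕ => R k z) atTop atTop :=
      (tendsto_atTop_add_const_right _ _ tendsto_natCast_atTop_atTop).atTop_mul_const hz'
    exact this.eventually_gt_atTop 2
  have hχb (k : ℕ) (z : ℂ) : ‖(χ k z : ℂ)‖ ≤ 1 := by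
    rw [Complex.norm_real]; exact norm_cutoffProfile_le _
  have hlim (F : ℂ → ℂ) (hF : Continuous F) (v : L2Disk) :
      Tendsto (fun k => ∫ z, (χ k z : ℂ) * F z * v z ∂diskMeasure) atTop
        (𝓝 (∫ z, F z * v z ∂diskMeasure)) := by
    refine tendsto_integral_of_dominated_convergence (fun z => ‖F z * v z‖) (fun k => ?_)
      (integrable_mul_L2Disk F hF v).norm (fun k => ?_) ?_
    · have : Continuous fun z => (χ k z : ℂ) * F z :=
        (Complex.continuous_ofReal.comp (contDiff_diskCutoff _).continuous).mul hF
      exact (integrable_mul_L2Disk _ this v).aestronglyMeasurable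
    · refine Eventually.of_forall fun z => ?_
      rw [mul_assoc, norm_mul]
      exact mul_le_of_le_one_left (norm_nonneg _) (hχb k z)
    · filter_upwards [ae_disk_mem_ball] with z hz
      refine tendsto_const_nhds.congr' ?_
      filter_upwards [hχ1 z hz] with k hk2
      rw [show χ k z = 1 from cutoffProfile_eq_one hk2.le, Complex.ofReal_one, one_mul]
  have hRc (k : ℕ) : Continuous (R k) := by simp only [hR]; fun_prop
  have hc' : Continuous (deriv cutoffProfile) := contDiff_cutoffProfile.continuous_deriv (by simp)
  have hBc (k : ℕ) : Continuous fun z =>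
      ((-2 * (R k z * deriv cutoffProfile (R k z)) : ℝ) : ℂ) * g z := by
    have := hRc k
    fun_prop
  obtain ⟨M, hM⟩ := exists_bound_mul_deriv_cutoffProfile
  -- The boundary-layer term disappears by dominated convergence, with the uniform bound `M`.
  have hlimB : Tendsto (fun k => ∫ z, ((-2 * (R k z * deriv cutoffProfile (R k z)) : ℝ) : ℂ) *
      g z * u z ∂diskMeasure) atTop (𝓝 0) := by
    have : (0 : ℂ) = ∫ _ : ℂ, (0 : ℂ) ∂diskMeasure := by simp
    rw [this]
    refine tendsto_integral_of_dominated_convergence (fun z => 2 * M * ‖g z * u z‖) (fun k => ?_)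
      ((integrable_mul_L2Disk g hg u).norm.const_mul _) (fun k => ?_) ?_
    · exact (integrable_mul_L2Disk _ (hBc k) u).aestronglyMeasurable
    · refine Eventually.of_forall fun z => ?_
      rw [mul_assoc, norm_mul, Complex.norm_real, norm_mul]
      refine mul_le_mul_of_nonneg_right ?_ (norm_nonneg _)
      have := hM (R k z)
      norm_num
      simpa using this
    · filter_upwards [ae_disk_mem_ball] with z hz
      refine tendsto_const_nhds.congr' ?_
      filter_upwards [hχ1 z hz] with k hk2
      simp [deriv_cutoffProfile_of_gt hk2]
  have hD : Continuous fun z => fderiv ℝ F₁ z 1 + fderiv ℝ F₂ z Complex.I :=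
    (continuous_fderiv_apply h₁ _).add (continuous_fderiv_apply h₂ _)
  have hL := ((hlim _ hD u).add hlimB)
  have hRr := ((hlim _ h₁.continuous gx).add (hlim _ h₂.continuous gy)).neg
  rw [add_zero] at hL
  have : ∀ k, ∫ z, (χ k z : ℂ) * (fderiv ℝ F₁ z 1 + fderiv ℝ F₂ z Complex.I) * u z ∂diskMeasure +
      ∫ z, ((-2 * (R k z * deriv cutoffProfile (R k z)) : ℝ) : ℂ) * g z * u z ∂diskMeasure =
      -(∫ z, (χ k z : ℂ) * F₁ z * gx z ∂diskMeasure +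
        ∫ z, (χ k z : ℂ) * F₂ z * gy z ∂diskMeasure) := by
    intro k
    have hc : Continuous fun z =>
        (χ k z : ℂ) * (fderiv ℝ F₁ z 1 + fderiv ℝ F₂ z Complex.I) :=
      (Complex.continuous_ofReal.comp (contDiff_diskCutoff _).continuous).mul hD
    rw [← hid k, ← integral_add (integrable_mul_L2Disk _ hc u)
      (integrable_mul_L2Disk _ (hBc k) u)]
    simp only [add_mul]
  simp only [this] at hL
  rw [tendsto_nhds_unique hL hRr, neg_neg]

lemma setIntegral_disk_eq {f : ℂ → ℂ} (hf : Function.support f ⊆ Metric.closedBall 0 1) :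
    ∫ z, f z ∂diskMeasure = ∫ z, f z := by
  refine setIntegral_eq_integral_of_forall_compl_eq_zero fun z hz => ?_
  by_contra h
  exact hz (hf h)

lemma support_fderiv_apply_subset {F : Type*} [NormedAddCommGroup F] [NormedSpace ℝ F]
    (φ : ℂ → F) (e : ℂ) : Function.support (fun z => fderiv ℝ φ z e) ⊆ tsupport φ := by
  refine Subset.trans (fun z hz => ?_) (support_fderiv_subset ℝ (f := φ))
  intro h0
  exact hz (by simp [h0])

/-- The classical derivative of a smooth function is a weak derivative. -/
lemma isWeakDeriv_contL2 (e : ℂ) (f g : C(ℂ, ℂ)) (hf : ContDiff ℝ ∞ f)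
    (hg : ∀ z, fderiv ℝ f z e = g z) : IsWeakDeriv e (contL2 f) (contL2 g) := by
  intro φ hφ hc hs
  -- Because `φ` is supported in the open disk, the integrals may be taken over the whole plane,
  -- where integration by parts has no boundary term.
  have e1 : ∫ z, (fderiv ℝ φ z e) • contL2 f z ∂diskMeasure =
      ∫ z, (fderiv ℝ φ z e) • f z := by
    rw [← setIntegral_disk_eq]
    · refine integral_congr_ae ?_
      filter_upwards [coeFn_contL2 f] with z hz
      rw [hz]
    · refine Subset.trans (fun z hz => ?_) (hs.trans Metric.ball_subset_closedBall)
      refine support_fderiv_apply_subset φ e fun h0 => hz ?_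
      simp only [h0, zero_smul]
  have e2 : ∫ z, φ z • contL2 g z ∂diskMeasure = ∫ z, φ z • fderiv ℝ f z e := by
    simp only [hg]
    rw [← setIntegral_disk_eq]
    · refine integral_congr_ae ?_
      filter_upwards [coeFn_contL2 g] with z hz
      rw [hz]
    · refine Subset.trans (fun z hz => ?_) (hs.trans Metric.ball_subset_closedBall)
      exact subset_tsupport φ fun h0 => hz (by simp only [h0, zero_smul])
  have hc1 : HasCompactSupport fun z => fderiv ℝ φ z e :=
    hc.mono' (support_fderiv_apply_subset φ e)
  rw [e1, e2, integral_smul_fderiv_eq_neg_fderiv_smul_of_integrable, neg_neg]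
  · exact ((continuous_fderiv_apply hφ e).smul hf.continuous).integrable_of_hasCompactSupport
      hc1.smul_right
  · exact (hφ.continuous.smul (continuous_fderiv_apply hf e)).integrable_of_hasCompactSupport
      hc.smul_right
  · exact (hφ.continuous.smul hf.continuous).integrable_of_hasCompactSupport hc.smul_right
  · exact fun z _ => differentiable_of_smooth hφ z
  · exact fun z _ => differentiable_of_smooth hf z

/-! ### Weak derivatives as a closed linear relation, and the closed graph theorem -/

/-- A real-valued test function as a complex-valued continuous function. -/
def realTest (φ : ℂ → ℝ) (hφ : Continuous φ) : C(ℂ, ℂ) :=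
  ⟨fun z => (φ z : ℂ), Complex.continuous_ofReal.comp hφ⟩

lemma integral_smul_eq_inner (φ : ℂ → ℝ) (hφ : Continuous φ) (u : L2Disk) :
    ∫ z, φ z • u z ∂diskMeasure = inner ℂ (contL2 (realTest φ hφ)) u := by
  rw [inner_contL2_left]
  simp [realTest]

/-- For each test function the condition is the vanishing of a continuous linear functional of `(u,
g)`; linearity and closedness of the relation follow. The conjugation in the inner product is
harmless, as test functions are real. -/
lemma isWeakDeriv_iff_inner (e : ℂ) (u g : L2Disk) : IsWeakDeriv e u g ↔
    ∀ (φ : ℂ → ℝ) (hφ : ContDiff ℝ ∞ φ), HasCompactSupport φ →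
      tsupport φ ⊆ Metric.ball (0 : ℂ) 1 →
      inner ℂ (contL2 (realTest _ (continuous_fderiv_apply hφ e))) u +
        inner ℂ (contL2 (realTest φ hφ.continuous)) g = 0 := by
  refine forall_congr' fun φ => forall_congr' fun hφ => forall_congr' fun _ =>
    forall_congr' fun _ => ?_
  rw [integral_smul_eq_inner _ (continuous_fderiv_apply hφ e),
    integral_smul_eq_inner _ hφ.continuous, eq_neg_iff_add_eq_zero]

lemma IsWeakDeriv.add {e : ℂ} {u v g h : L2Disk} (hu : IsWeakDeriv e u g)
    (hv : IsWeakDeriv e v h) : IsWeakDeriv e (u + v) (g + h) := by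
  rw [isWeakDeriv_iff_inner] at *
  intro φ hφ hc hs
  rw [inner_add_right, inner_add_right]
  linear_combination hu φ hφ hc hs + hv φ hφ hc hs

lemma IsWeakDeriv.smul {e : ℂ} {u g : L2Disk} (c : ℂ) (hu : IsWeakDeriv e u g) :
    IsWeakDeriv e (c • u) (c • g) := by
  rw [isWeakDeriv_iff_inner] at *
  intro φ hφ hc hs
  rw [inner_smul_right, inner_smul_right]
  linear_combination c * hu φ hφ hc hs

lemma isClosed_isWeakDeriv (e : ℂ) :
    IsClosed {p : L2Disk × L2Disk | IsWeakDeriv e p.1 p.2} := by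
  simp only [isWeakDeriv_iff_inner, ofPred_forall]
  refine isClosed_iInter fun φ => isClosed_iInter fun hφ => isClosed_iInter fun _ =>
    isClosed_iInter fun _ => isClosed_eq ?_ continuous_const
  exact (continuous_const.inner continuous_fst).add (continuous_const.inner continuous_snd)

/-- The fundamental lemma of the calculus of variations gives `g = 0` on the open disk, and the
boundary circle is null. -/
lemma isWeakDeriv_zero_left {e : ℂ} {g : L2Disk} (h : IsWeakDeriv e 0 g) : g = 0 := by
  have hg : ∀ᵐ z ∂diskMeasure, z ∈ Metric.ball (0 : ℂ) 1 → g z = 0 := by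
    refine Metric.isOpen_ball.ae_eq_zero_of_integral_contDiff_smul_eq_zero
      ((integrable_L2Disk g).locallyIntegrable.locallyIntegrableOn _) fun φ hφ hc hs => ?_
    have := (isWeakDeriv_iff_inner e 0 g).1 h φ hφ hc hs
    rw [inner_zero_right, zero_add] at this
    rw [integral_smul_eq_inner _ hφ.continuous, this]
  refine (Lp.eq_zero_iff_ae_eq_zero).2 ?_
  filter_upwards [hg, ae_disk_mem_ball] with z h1 h2 using h1 h2

lemma IsWeakDeriv.unique {e : ℂ} {u g g' : L2Disk} (h : IsWeakDeriv e u g)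
    (h' : IsWeakDeriv e u g') : g = g' := by
  have h2 := h.add (h'.smul (-1))
  rw [neg_one_smul, neg_one_smul, add_neg_cancel, ← sub_eq_add_neg] at h2
  exact sub_eq_zero.1 (isWeakDeriv_zero_left h2)

/-- Closed graph theorem: an operator of `L²(D)` with values in `H¹(D)` is bounded from `L²(D)` to
`H¹(D)`. -/
lemma isBoundedL2H1_of_forall_mem_H1 (A : L2Disk →L[ℂ] L2Disk) (hA : ∀ f, A f ∈ H1) :
    IsBoundedL2H1 A := by
  have deriv (e : ℂ) (T : L2Disk → L2Disk) (hT : ∀ f, IsWeakDeriv e (A f) (T f)) :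
      ∃ C : ℝ, 0 ≤ C ∧ ∀ f, ‖T f‖ ≤ C * ‖f‖ := by
    -- Uniqueness of weak derivatives makes the chosen `T` linear and identifies its graph with the
    -- preimage of a closed relation.
    let L : L2Disk →ₗ[ℂ] L2Disk :=
      { toFun := T
        map_add' := fun f g => (hT (f + g)).unique (by
          rw [map_add]; exact (hT f).add (hT g))
        map_smul' := fun c f => (hT (c • f)).unique (by
          rw [map_smul]; exact (hT f).smul c) }
    have hL : IsClosed (L.graph : Set (L2Disk × L2Disk)) := by
      have : (L.graph : Set (L2Disk × L2Disk)) = (fun p : L2Disk × L2Disk => (A p.1, p.2)) ⁻¹'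
          {p : L2Disk × L2Disk | IsWeakDeriv e p.1 p.2} := by
        ext p
        rw [SetLike.mem_coe, LinearMap.mem_graph_iff]
        constructor
        · intro h
          rw [mem_preimage, h]
          exact hT p.1
        · intro h
          exact IsWeakDeriv.unique h (hT p.1)
      rw [this]
      exact (isClosed_isWeakDeriv e).preimage
        ((A.continuous.comp continuous_fst).prodMk continuous_snd)
    let M : L2Disk →L[ℂ] L2Disk := ⟨L, L.continuous_of_isClosed_graph hL⟩
    exact ⟨‖M‖, norm_nonneg _, M.le_opNorm⟩
  choose gx gy hg using hA
  obtain ⟨C₁, hC₁, h₁⟩ := deriv 1 gx fun f => (hg f).1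
  obtain ⟨C₂, hC₂, h₂⟩ := deriv Complex.I gy fun f => (hg f).2
  refine ⟨‖A‖ + C₁ + C₂, by positivity, fun f => ⟨gx f, gy f, hg f, ?_⟩⟩
  rw [Real.sqrt_le_left (by positivity)]
  have h0 := A.le_opNorm f
  have hb : (0 : ℝ) ≤ ‖A‖ * ‖f‖ := by positivity
  have hb₁ : (0 : ℝ) ≤ C₁ * ‖f‖ := by positivity
  have hb₂ : (0 : ℝ) ≤ C₂ * ‖f‖ := by positivity
  calc ‖A f‖ ^ 2 + ‖gx f‖ ^ 2 + ‖gy f‖ ^ 2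
      ≤ (‖A‖ * ‖f‖) ^ 2 + (C₁ * ‖f‖) ^ 2 + (C₂ * ‖f‖) ^ 2 := by
        gcongr
        · exact h₁ f
        · exact h₂ f
    _ ≤ _ := by nlinarith [mul_nonneg hb hb₁, mul_nonneg hb hb₂, mul_nonneg hb₁ hb₂]

/-! ### Chords in parallel-beam coordinates and Santaló's formula -/

/-- The point with abscissa `t` on the chord with direction angle `b + π` at signed distance `s`
from the origin. -/
def chordPoint (b s t : ℝ) : ℂ := -Complex.exp (b * Complex.I) * ⟨t, s⟩

lemma continuous_chordPoint : Continuous fun q : ℝ × ℝ × ℝ => chordPoint q.1 q.2.1 q.2.2 := by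
  unfold chordPoint
  simp_rw [Complex.mk_eq_add_mul_I]
  fun_prop

/-- Along a chord every ridge coordinate is affine in the parameter `t`. For `a = b` it is the
constant `s`, so `lineCoord b` labels the chords of direction angle `b + π`. -/
lemma lineCoord_chordPoint (a b s t : ℝ) :
    lineCoord a (chordPoint b s t) = s * Real.cos (a - b) - t * Real.sin (a - b) := by
  have h : chordPoint b s t = ⟨-(t * Real.cos b - s * Real.sin b),
      -(t * Real.sin b + s * Real.cos b)⟩ := by
    unfold chordPoint
    rw [Complex.exp_mul_I, ← Complex.ofReal_cos, ← Complex.ofReal_sin]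
    apply Complex.ext <;> simp [-Complex.ofReal_cos, -Complex.ofReal_sin] <;> ring
  rw [h, lineCoord, Real.cos_sub, Real.sin_sub]
  ring

/-- The integral of `f` over the chord with direction angle `b + π` at signed distance `s`. -/
def chordIntegral (f : ℂ → ℂ) (b s : ℝ) : ℂ :=
  ∫ t in -Real.sqrt (1 - s ^ 2)..Real.sqrt (1 - s ^ 2), f (chordPoint b s t)

lemma sqrt_one_sub_sin_sq {a : ℝ} (ha : a ∈ Ioo (-(Real.pi / 2)) (Real.pi / 2)) :
    Real.sqrt (1 - Real.sin a ^ 2) = Real.cos a := by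
  rw [← Real.cos_sq', Real.sqrt_sq (Real.cos_pos_of_mem_Ioo ha).le]

/-- Passage from fan-beam to parallel-beam coordinates, `b = β + α` and `s = sin α`. The shift of
`t` by `cos α` puts the origin of the parameter at the midpoint of the chord. -/
lemma xray_eq_chordIntegral (f : ℂ → ℂ) (p : ℝ × ℝ)
    (hp : p.2 ∈ Ioo (-(Real.pi / 2)) (Real.pi / 2)) :
    xray f p = chordIntegral f (p.1 + p.2) (Real.sin p.2) := by
  unfold xray chordIntegral
  simp_rw [ray_eq]
  rw [intervalIntegral.integral_comp_sub_right
    (fun t => f (-Complex.exp ((p.1 + p.2 : ℝ) * Complex.I) * ⟨t, Real.sin p.2⟩)) (Real.cos p.2),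
    sqrt_one_sub_sin_sq hp, exitTime]
  congr 1 <;> ring

lemma continuous_chordIntegral (f : ℂ → ℂ) (hf : Continuous f) :
    Continuous fun q : ℝ × ℝ => chordIntegral f q.1 q.2 := by
  have hF : Continuous (Function.uncurry fun (q : ℝ × ℝ) (t : ℝ) =>
      f (chordPoint q.1 q.2 t)) :=
    hf.comp (continuous_chordPoint.comp
      (by fun_prop : Continuous fun x : (ℝ × ℝ) × ℝ => (x.1.1, x.1.2, x.2)))
  have hs : Continuous fun q : ℝ × ℝ => Real.sqrt (1 - q.2 ^ 2) := by fun_prop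
  have h1 := intervalIntegral.continuous_parametric_intervalIntegral_of_continuous
    (μ := volume) (a₀ := 0) hF hs
  have h2 := intervalIntegral.continuous_parametric_intervalIntegral_of_continuous
    (μ := volume) (a₀ := 0) hF hs.neg
  refine (h1.sub h2).congr fun q => ?_
  have hi (a b : ℝ) : IntervalIntegrable (fun t => f (chordPoint q.1 q.2 t)) volume a b :=
    (hF.comp (by fun_prop : Continuous fun t : ℝ => (q, t))).intervalIntegrable a b
  exact intervalIntegral.integral_interval_sub_left (hi _ _) (hi _ _)

lemma integral_disk_comp_rotation (Φ : ℂ → ℂ) (b : ℝ) :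
    ∫ z, Φ (-Complex.exp (b * Complex.I) * z) ∂diskMeasure = ∫ z, Φ z ∂diskMeasure := by
  let c : Circle := ⟨-Complex.exp (b * Complex.I), by
    simp [Submonoid.unitSphere, Complex.norm_exp_ofReal_mul_I]⟩
  have hpre : (rotation c) ⁻¹' Metric.closedBall (0 : ℂ) 1 = Metric.closedBall 0 1 := by
    ext z
    rw [mem_preimage, mem_closedBall_zero_iff, mem_closedBall_zero_iff,
      LinearIsometryEquiv.norm_map]
  have := (rotation c).measurePreserving.setIntegral_preimage_emb
    (rotation c).toHomeomorph.measurableEmbedding Φ (Metric.closedBall 0 1)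
  rw [hpre] at this
  exact this

lemma integral_disk_eq (Ψ : ℂ → ℂ) (hΨ : Continuous Ψ) :
    ∫ z, Ψ z ∂diskMeasure = ∫ s in (-1 : ℝ)..1,
      ∫ t in -Real.sqrt (1 - s ^ 2)..Real.sqrt (1 - s ^ 2), Ψ ⟨t, s⟩ := by
  have hmem (s t : ℝ) : (⟨t, s⟩ : ℂ) ∈ Metric.closedBall (0 : ℂ) 1 ↔ t ^ 2 + s ^ 2 ≤ 1 := by
    rw [mem_closedBall_zero_iff, ← sq_le_one_iff₀ (norm_nonneg _), sq_norm_eq]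
  have hint : Integrable ((Metric.closedBall (0 : ℂ) 1).indicator Ψ) :=
    (hΨ.continuousOn.integrableOn_compact (isCompact_closedBall _ _)).integrable_indicator
      Metric.isClosed_closedBall.measurableSet
  have hmp := Complex.volume_preserving_equiv_real_prod.symm
  have hint' : Integrable (fun q : ℝ × ℝ => (Metric.closedBall (0 : ℂ) 1).indicator Ψ ⟨q.1, q.2⟩)
      (volume.prod volume) := hmp.integrable_comp_of_integrable hint
  have e1 : ∫ z, (Metric.closedBall (0 : ℂ) 1).indicator Ψ z =
      ∫ q : ℝ × ℝ, (Metric.closedBall (0 : ℂ) 1).indicator Ψ ⟨q.1, q.2⟩ :=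
    (hmp.integral_comp' (g := (Metric.closedBall (0 : ℂ) 1).indicator Ψ)).symm
  rw [diskMeasure, ← integral_indicator Metric.isClosed_closedBall.measurableSet, e1,
    Measure.volume_eq_prod, integral_prod_symm _ hint',
    intervalIntegral.integral_of_le (by norm_num), ← integral_Icc_eq_integral_Ioc,
    ← integral_indicator measurableSet_Icc]
  congr 1 with s
  by_cases hs : s ∈ Icc (-1 : ℝ) 1
  · have hs' : 0 ≤ 1 - s ^ 2 := by nlinarith [hs.1, hs.2]
    have hle : -Real.sqrt (1 - s ^ 2) ≤ Real.sqrt (1 - s ^ 2) := by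
      linarith [Real.sqrt_nonneg (1 - s ^ 2)]
    rw [indicator_of_mem hs, intervalIntegral.integral_of_le hle, ← integral_Icc_eq_integral_Ioc,
      ← integral_indicator measurableSet_Icc]
    congr 1 with t
    have : (⟨t, s⟩ : ℂ) ∈ Metric.closedBall (0 : ℂ) 1 ↔
        t ∈ Icc (-Real.sqrt (1 - s ^ 2)) (Real.sqrt (1 - s ^ 2)) := by
      rw [hmem, mem_Icc, ← abs_le, ← Real.sqrt_sq_eq_abs, Real.sqrt_le_sqrt_iff hs']
      constructor <;> intro h <;> linarith
    by_cases ht : t ∈ Icc (-Real.sqrt (1 - s ^ 2)) (Real.sqrt (1 - s ^ 2))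
    · rw [indicator_of_mem ht, indicator_of_mem (this.2 ht)]
    · rw [indicator_of_notMem ht, indicator_of_notMem (mt this.1 ht)]
  · rw [indicator_of_notMem hs]
    refine integral_eq_zero_of_ae (Eventually.of_forall fun t => ?_)
    refine indicator_of_notMem (fun h => hs ?_) _
    rw [hmem] at h
    exact abs_le.1 (abs_le_of_sq_le_sq (by nlinarith) zero_le_one)

lemma integrable_fan (G : ℝ × ℝ → ℂ) (hG : Continuous G) : Integrable G fanMeasure := by
  unfold fanMeasure
  rw [Measure.prod_restrict]
  refine IntegrableOn.mono_set (hG.continuousOn.integrableOn_compact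
    (isCompact_Icc (a := ((0 : ℝ), -(Real.pi / 2))) (b := (2 * Real.pi, Real.pi / 2)))) ?_
  rintro ⟨x, y⟩ ⟨hx, hy⟩
  exact ⟨⟨hx.1.le, hy.1.le⟩, ⟨hx.2, hy.2.le⟩⟩

lemma integral_fan_eq (G : ℝ × ℝ → ℂ) (hG : Continuous G) :
    ∫ p, G p ∂fanMeasure = ∫ a in -(Real.pi / 2)..(Real.pi / 2),
      ∫ b in (0 : ℝ)..(2 * Real.pi), G (b, a) := by
  have hi := integrable_fan G hG
  unfold fanMeasure at *
  rw [integral_prod_symm _ hi, intervalIntegral.integral_of_le (by linarith [Real.pi_pos]),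
    integral_Ioc_eq_integral_Ioo]
  simp_rw [intervalIntegral.integral_of_le Real.two_pi_pos.le]

lemma periodic_integral_comp_add {K : ℝ → ℂ} (hK : Function.Periodic K (2 * Real.pi)) (a : ℝ) :
    ∫ b in (0 : ℝ)..(2 * Real.pi), K (b + a) = ∫ b in (0 : ℝ)..(2 * Real.pi), K b := by
  rw [intervalIntegral.integral_comp_add_right, zero_add, add_comm (2 * Real.pi),
    hK.intervalIntegral_add_eq a 0, zero_add]

lemma chordPoint_periodic (s t : ℝ) :
    Function.Periodic (fun b => chordPoint b s t) (2 * Real.pi) := by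
  intro b
  simp only [chordPoint]
  rw [show ((b + 2 * Real.pi : ℝ) * Complex.I) = b * Complex.I + 2 * Real.pi * Complex.I by
    push_cast; ring, Complex.exp_periodic]

lemma chordIntegral_periodic (f : ℂ → ℂ) (s : ℝ) :
    Function.Periodic (fun b => chordIntegral f b s) (2 * Real.pi) := by
  intro b
  have h (t : ℝ) : chordPoint (b + 2 * Real.pi) s t = chordPoint b s t :=
    chordPoint_periodic s t b
  simp only [chordIntegral, h]

/-- Santaló's formula on the disk, weighted by a function of the line. -/
lemma integral_fan_mul_xray (K : ℝ → ℝ → ℂ) (hK : Continuous fun q : ℝ × ℝ => K q.1 q.2)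
    (hper : ∀ s, Function.Periodic (fun b => K b s) (2 * Real.pi)) (f : ℂ → ℂ)
    (hf : Continuous f) :
    ∫ p, (Real.cos p.2 * K (p.1 + p.2) (Real.sin p.2)) * xray f p ∂fanMeasure =
      ∫ z, (∫ b in (0 : ℝ)..(2 * Real.pi), K b (lineCoord b z)) * f z ∂diskMeasure := by
  set L : ℝ → ℝ → ℂ := fun b s => K b s * chordIntegral f b s with hL
  have hcL : Continuous fun q : ℝ × ℝ => L q.1 q.2 := hK.mul (continuous_chordIntegral f hf)
  have hG : Continuous fun p : ℝ × ℝ => (Real.cos p.2 : ℂ) * L (p.1 + p.2) (Real.sin p.2) := by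
    have := hcL.comp (by fun_prop : Continuous fun p : ℝ × ℝ => (p.1 + p.2, Real.sin p.2))
    exact (by fun_prop : Continuous fun p : ℝ × ℝ => (Real.cos p.2 : ℂ)).mul this
  have hLper (s : ℝ) : Function.Periodic (fun b => L b s) (2 * Real.pi) :=
    (hper s).mul (chordIntegral_periodic f s)
  have hcH : Continuous fun s : ℝ => ∫ b in (0 : ℝ)..(2 * Real.pi), L b s :=
    intervalIntegral.continuous_parametric_intervalIntegral_of_continuous'
      (f := fun s b => L b s) (hcL.comp continuous_swap) _ _
  have hcC : Continuous fun q : ℝ × ℂ => K q.1 (lineCoord q.1 q.2) * f q.2 :=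
    (hK.comp (continuous_fst.prodMk (continuous_lineCoord.comp continuous_swap))).mul
      (hf.comp continuous_snd)
  calc ∫ p, (Real.cos p.2 * K (p.1 + p.2) (Real.sin p.2)) * xray f p ∂fanMeasure
      = ∫ p, (Real.cos p.2 : ℂ) * L (p.1 + p.2) (Real.sin p.2) ∂fanMeasure := by
        refine integral_congr_ae ?_
        filter_upwards [ae_fan_cos_pos] with p hp
        rw [xray_eq_chordIntegral f p hp, hL, mul_assoc]
    _ = ∫ a in -(Real.pi / 2)..(Real.pi / 2),
          ∫ b in (0 : ℝ)..(2 * Real.pi), (Real.cos a : ℂ) * L (b + a) (Real.sin a) :=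
        integral_fan_eq _ hG
    _ = ∫ a in -(Real.pi / 2)..(Real.pi / 2), Real.cos a •
          ((fun s => ∫ b in (0 : ℝ)..(2 * Real.pi), L b s) ∘ Real.sin) a := by
        congr 1 with a
        -- For fixed `α`, periodicity replaces `β + α` by `b` over the same period.
        rw [intervalIntegral.integral_const_mul, periodic_integral_comp_add (hLper _) a,
          Complex.real_smul]
        rfl
    -- The weight `cos α` is the Jacobian of `s = sin α`.
    _ = ∫ s in (-1 : ℝ)..1, ∫ b in (0 : ℝ)..(2 * Real.pi), L b s := by
        rw [intervalIntegral.integral_deriv_smul_comp (fun a _ => Real.hasDerivAt_sin a)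
          Real.continuous_cos.continuousOn hcH, Real.sin_neg, Real.sin_pi_div_two]
    _ = ∫ b in (0 : ℝ)..(2 * Real.pi), ∫ s in (-1 : ℝ)..1, L b s := by
        refine intervalIntegral_intervalIntegral_swap ?_
        refine IntegrableOn.mono_set ((hcL.comp continuous_swap).continuousOn.integrableOn_compact
          (isCompact_uIcc.prod isCompact_uIcc)) (prod_mono uIoc_subset_uIcc uIoc_subset_uIcc)
    _ = ∫ b in (0 : ℝ)..(2 * Real.pi), ∫ z, K b (lineCoord b z) * f z ∂diskMeasure := by
        congr 1 with b
        have hc : Continuous fun z => K b (lineCoord b z) * f z :=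
          hcC.comp (by fun_prop : Continuous fun z : ℂ => (b, z))
        -- A rotation of the disk makes the chords of this direction horizontal, and Fubini then
        -- slices by `s`.
        rw [← integral_disk_comp_rotation _ b, integral_disk_eq]
        · congr 1 with s
          simp only [hL, chordIntegral]
          rw [← intervalIntegral.integral_const_mul]
          congr 1 with t
          change _ = K b (lineCoord b (chordPoint b s t)) * _
          rw [lineCoord_chordPoint]
          simp [chordPoint]
        · exact hc.comp (continuous_const.mul continuous_id)
    _ = _ := by
        rw [intervalIntegral.integral_of_le Real.two_pi_pos.le, integral_integral_swap]
        · simp_rw [integral_mul_const, intervalIntegral.integral_of_le Real.two_pi_pos.le]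
        · unfold diskMeasure
          rw [Measure.prod_restrict]
          exact IntegrableOn.mono_set (hcC.continuousOn.integrableOn_compact
            (isCompact_Icc.prod (isCompact_closedBall (0 : ℂ) 1)))
            (prod_mono Ioc_subset_Icc_self subset_rfl)

lemma denseRange_contL2 : DenseRange contL2 := by
  have : diskMeasure.WeaklyRegular := inferInstance
  refine (BoundedContinuousFunction.toLp_denseRange ℂ diskMeasure ℂ
    (p := 2) ENNReal.ofNat_ne_top).mono ?_
  rintro _ ⟨f, rfl⟩
  refine ⟨f.toContinuousMap, Lp.ext ?_⟩
  filter_upwards [coeFn_contL2 f.toContinuousMap,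
    BoundedContinuousFunction.coeFn_toLp 2 diskMeasure ℂ f] with z h1 h2
  rw [h1, h2]; rfl

lemma coeFn_I₀ (f : L2Disk) : I₀ f =ᵐ[fanMeasure] xray f := MemLp.coeFn_toLp (memLp_xray f)

lemma coeFn_I₀_contL2 (f : C(ℂ, ℂ)) : I₀ (contL2 f) =ᵐ[fanMeasure] xray f := by
  filter_upwards [coeFn_I₀ (contL2 f), ae_ray (coeFn_contL2 f), ae_exitTime_pos] with p h1 h2 h3
  rw [h1, xray_eq_of_cos_nonneg _ p h3.le, xray_eq_of_cos_nonneg _ p h3.le]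
  exact integral_congr_ae h2

/-! ### Chebyshev polynomials and chord integrals -/

/-- This is `U_n(cos θ) sin θ = sin((n+1)θ)` at `θ = π/2 - a`; the powers of `i` come from
`e^{i(n+1)π/2}`. The right-hand side is the last factor of `psiFun`. -/
lemma two_mul_I_pow_mul_U_sin (n : ℕ) (a : ℂ) :
    2 * Complex.I ^ n * ((U ℂ n).eval (Complex.sin a) * Complex.cos a) =
      Complex.exp (Complex.I * (n + 1) * a) +
        (-1) ^ n * Complex.exp (-(Complex.I * (n + 1) * a)) := by
  have h := Chebyshev.U_complex_cos (Real.pi / 2 - a) n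
  rw [Complex.cos_pi_div_two_sub, Complex.sin_pi_div_two_sub] at h
  rw [h]
  have e0 : Complex.exp (Real.pi / 2 * Complex.I) = Complex.I := Complex.exp_pi_div_two_mul_I
  have e1 : Complex.exp (((n : ℤ) + 1) * (Real.pi / 2 - a) * Complex.I) =
      Complex.I ^ (n + 1) * Complex.exp (-(Complex.I * (n + 1) * a)) := by
    rw [show ((n : ℤ) + 1) * (Real.pi / 2 - a) * Complex.I =
      ((n + 1 : ℕ) : ℂ) * (Real.pi / 2 * Complex.I) + -(Complex.I * (n + 1) * a) by
        push_cast; ring, Complex.exp_add, Complex.exp_nat_mul, e0]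
  have e2 : Complex.exp (-(((n : ℤ) + 1) * (Real.pi / 2 - a)) * Complex.I) =
      (-Complex.I) ^ (n + 1) * Complex.exp (Complex.I * (n + 1) * a) := by
    rw [show -(((n : ℤ) + 1) * (Real.pi / 2 - a)) * Complex.I =
      ((n + 1 : ℕ) : ℂ) * (-(Real.pi / 2 * Complex.I)) + (Complex.I * (n + 1) * a) by
        push_cast; ring, Complex.exp_add, Complex.exp_nat_mul, Complex.exp_neg, e0,
        Complex.inv_I]
  rw [Complex.sin, e1, e2]
  have e3 : Complex.I ^ n * Complex.I * (-Complex.I) ^ (n + 1) = 1 := by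
    rw [← pow_succ, ← mul_pow]; simp
  have e4 : Complex.I ^ n * Complex.I * Complex.I ^ (n + 1) = (-1) ^ (n + 1) := by
    rw [← pow_succ, ← mul_pow]; simp
  have e5 : ((-1 : ℂ)) ^ (n + 1) = - (-1) ^ n := by rw [pow_succ]; ring
  linear_combination Complex.exp (Complex.I * (n + 1) * a) * e3 -
    Complex.exp (-(Complex.I * (n + 1) * a)) * (e4 + e5)

/-- The integral of a ridge Chebyshev polynomial over a chord of the unit circle. -/
lemma integral_U_ridge (n : ℕ) (φ δ : ℝ) (hδ : Real.sin δ ≠ 0) :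
    ∫ t in -Real.sin φ..Real.sin φ,
      (U ℂ n).eval ((Real.cos φ * Real.cos δ - t * Real.sin δ : ℝ) : ℂ) =
      2 / (n + 1) * ((U ℂ n).eval (Real.cos φ : ℂ) * Real.sin φ) *
        (U ℂ n).eval (Real.cos δ : ℂ) := by
  have hδ' : (Real.sin δ : ℂ) ≠ 0 := Complex.ofReal_ne_zero.2 hδ
  have hn : ((n : ℂ) + 1) ≠ 0 := Nat.cast_add_one_ne_zero n
  -- The antiderivative comes from `T_{n+1}' = (n+1) U_n`; the argument has slope `-sin δ`, which
  -- must not vanish.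
  have hder (t : ℝ) : HasDerivAt (fun t : ℝ => -((n + 1) * (Real.sin δ : ℂ))⁻¹ *
      (T ℂ (n + 1 : ℤ)).eval ((Real.cos φ * Real.cos δ - t * Real.sin δ : ℝ) : ℂ))
      ((U ℂ n).eval ((Real.cos φ * Real.cos δ - t * Real.sin δ : ℝ) : ℂ)) t := by
    have h1 : HasDerivAt (fun t : ℝ => ((Real.cos φ * Real.cos δ - t * Real.sin δ : ℝ) : ℂ))
        ((-Real.sin δ : ℝ) : ℂ) t := by
      have := (((hasDerivAt_id t).mul_const (Real.sin δ)).const_sub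
        (Real.cos φ * Real.cos δ)).ofReal_comp
      simpa using this
    have h2 := (((T ℂ (n + 1 : ℤ)).hasDerivAt
      ((Real.cos φ * Real.cos δ - t * Real.sin δ : ℝ) : ℂ)).comp t h1).const_mul
      (-((n + 1) * (Real.sin δ : ℂ))⁻¹)
    refine h2.congr_deriv ?_
    rw [Chebyshev.T_derivative_eq_U, add_sub_cancel_right, eval_mul, eval_intCast]
    push_cast
    have hδ'' : Complex.sin δ ≠ 0 := by rwa [← Complex.ofReal_sin]
    field_simp
  rw [intervalIntegral.integral_eq_sub_of_hasDerivAt (fun t _ => hder t)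
    (Continuous.intervalIntegrable (by fun_prop) _ _)]
  have c1 : ((Real.cos φ * Real.cos δ - Real.sin φ * Real.sin δ : ℝ) : ℂ) =
      Complex.cos (φ + δ) := by
    rw [← Real.cos_add]; push_cast; rfl
  have c2 : ((Real.cos φ * Real.cos δ - -Real.sin φ * Real.sin δ : ℝ) : ℂ) =
      Complex.cos (φ - δ) := by
    rw [neg_mul, sub_neg_eq_add, ← Real.cos_sub]; push_cast; rfl
  -- At the endpoints the argument is `cos(φ ± δ)`. The difference of `cos((n+1)(φ ∓ δ))` is a
  -- product of sines, which separates `φ` from `δ`.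
  rw [c1, c2, Chebyshev.T_complex_cos, Chebyshev.T_complex_cos]
  have u1 := Chebyshev.U_complex_cos φ n
  have u2 := Chebyshev.U_complex_cos δ n
  push_cast at u1 u2 hδ' ⊢
  rw [u1]
  have e1 : Complex.cos (((n : ℂ) + 1) * (φ + δ)) = Complex.cos ((n + 1) * φ) *
      Complex.cos ((n + 1) * δ) - Complex.sin ((n + 1) * φ) * Complex.sin ((n + 1) * δ) := by
    rw [mul_add, Complex.cos_add]
  have e2 : Complex.cos (((n : ℂ) + 1) * (φ - δ)) = Complex.cos ((n + 1) * φ) *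
      Complex.cos ((n + 1) * δ) + Complex.sin ((n + 1) * φ) * Complex.sin ((n + 1) * δ) := by
    rw [mul_sub, Complex.cos_sub]
  rw [e1, e2, ← u2]
  field_simp
  ring

/-- Multiplication by `2i sin δ = e^{iδ} - e^{-iδ}` makes the sum telescope to `2i sin((n+1)δ)`. The
excluded `δ` form a null set. -/
lemma U_cos_eq_sum (n : ℕ) (δ : ℝ) (hδ : Real.sin δ ≠ 0) : (U ℂ n).eval (Real.cos δ : ℂ) =
    ∑ j ∈ Finset.range (n + 1), Complex.exp (Complex.I * (n - 2 * j) * δ) := by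
  have hδ' : Complex.sin δ ≠ 0 := by
    rw [← Complex.ofReal_sin]; exact Complex.ofReal_ne_zero.2 hδ
  have hs : 2 * Complex.I * Complex.sin δ =
      Complex.exp (Complex.I * δ) - Complex.exp (-(Complex.I * δ)) := by
    rw [Complex.sin, mul_comm Complex.I, ← neg_mul]
    linear_combination (Complex.exp (-(δ : ℂ) * Complex.I) - Complex.exp (δ * Complex.I)) *
      Complex.I_mul_I
  have hsum : 2 * Complex.I * Complex.sin δ *
      ∑ j ∈ Finset.range (n + 1), Complex.exp (Complex.I * (n - 2 * j) * δ) =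
      2 * Complex.I * Complex.sin ((n + 1) * δ) := by
    have : ∀ j ∈ Finset.range (n + 1), 2 * Complex.I * Complex.sin δ *
        Complex.exp (Complex.I * (n - 2 * j) * δ) =
        Complex.exp (Complex.I * (n + 1 - 2 * j) * δ) -
          Complex.exp (Complex.I * (n + 1 - 2 * (j + 1 : ℕ)) * δ) := by
      intro j _
      rw [hs, sub_mul, ← Complex.exp_add, ← Complex.exp_add]
      congr 2 <;> push_cast <;> ring
    rw [Finset.mul_sum, Finset.sum_congr rfl this,
      Finset.sum_range_sub' (fun j : ℕ => Complex.exp (Complex.I * (n + 1 - 2 * j) * δ)),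
      Complex.sin]
    have a1 : Complex.I * (n + 1 - 2 * ((0 : ℕ) : ℂ)) * δ = (n + 1) * δ * Complex.I := by
      push_cast; ring
    have a2 : Complex.I * (n + 1 - 2 * ((n + 1 : ℕ) : ℂ)) * δ = -((n + 1) * δ) * Complex.I := by
      push_cast; ring
    rw [a1, a2]
    linear_combination (Complex.exp ((n + 1) * δ * Complex.I) -
      Complex.exp (-((n + 1) * (δ : ℂ)) * Complex.I)) * Complex.I_mul_I
  have u := Chebyshev.U_complex_cos δ n
  have hne : 2 * Complex.I * Complex.sin δ ≠ 0 :=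
    mul_ne_zero (mul_ne_zero two_ne_zero Complex.I_ne_zero) hδ'
  refine mul_left_cancel₀ hne ?_
  rw [hsum, Complex.ofReal_cos]
  push_cast at u
  rw [← u]
  ring

lemma integral_exp_int_mul (m : ℤ) : ∫ b in (0 : ℝ)..(2 * Real.pi),
    Complex.exp (Complex.I * m * b) = if m = 0 then 2 * (Real.pi : ℂ) else 0 := by
  split_ifs with h
  · simp [h]
  · have hne : Complex.I * (m : ℂ) ≠ 0 :=
      mul_ne_zero Complex.I_ne_zero (Int.cast_ne_zero.2 h)
    rw [integral_exp_mul_complex hne, show Complex.I * (m : ℂ) * ((2 * Real.pi : ℝ) : ℂ) =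
      m * (2 * Real.pi * Complex.I) by push_cast; ring, Complex.exp_int_mul_two_pi_mul_I]
    simp

lemma ae_sin_ne_zero : ∀ᵐ δ : ℝ, Real.sin δ ≠ 0 := by
  have h : (range fun n : ℤ => (n : ℝ) * Real.pi).Countable := countable_range _
  filter_upwards [h.ae_notMem volume] with δ hδ h0
  obtain ⟨n, hn⟩ := Real.sin_eq_zero_iff.1 h0
  exact hδ ⟨n, hn⟩

/-- In the expansion of `U_n(cos δ)` only the term `j = n - k` cancels the frequency `n - 2k`; it
occurs because `k ≤ n`. -/
lemma integral_exp_mul_U_cos {n k : ℕ} (hk : k ≤ n) : ∫ δ in (0 : ℝ)..(2 * Real.pi),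
    Complex.exp (Complex.I * (n - 2 * k) * δ) * (U ℂ n).eval (Real.cos δ : ℂ) =
      2 * Real.pi := by
  have h1 : ∫ δ in (0 : ℝ)..(2 * Real.pi),
      Complex.exp (Complex.I * (n - 2 * k) * δ) * (U ℂ n).eval (Real.cos δ : ℂ) =
      ∫ δ in (0 : ℝ)..(2 * Real.pi), ∑ j ∈ Finset.range (n + 1),
        Complex.exp (Complex.I * ((2 * (n - k - j) : ℤ) : ℂ) * δ) := by
    refine intervalIntegral.integral_congr_ae ?_
    filter_upwards [ae_sin_ne_zero] with δ hδ _
    rw [U_cos_eq_sum n δ hδ, Finset.mul_sum]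
    refine Finset.sum_congr rfl fun j _ => ?_
    rw [← Complex.exp_add]
    congr 1
    push_cast; ring
  rw [h1, intervalIntegral.integral_finsetSum
    fun j _ => Continuous.intervalIntegrable (by fun_prop) _ _]
  simp_rw [integral_exp_int_mul]
  rw [Finset.sum_eq_single (n - k)]
  · rw [if_pos (by omega)]
  · intro j _ hj
    rw [if_neg (by omega)]
  · intro h
    exact absurd (Finset.mem_range.2 (by omega)) h

/-! ### The Zernike functions as polynomials -/

/-- A superposition of ridge polynomials as a continuous function. -/
def ridge (w : C(ℝ, ℂ)) (p : ℂ[X]) : C(ℂ, ℂ) := ⟨ridgeFun w p, continuous_ridgeFun w p⟩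

lemma ridge_apply (w : C(ℝ, ℂ)) (p : ℂ[X]) (z : ℂ) : ridge w p z = ridgeFun w p z := rfl

/-- The angular weight of the Zernike functions. -/
def zernikeWeight (n k : ℕ) : C(ℝ, ℂ) :=
  ⟨fun b => (-Complex.I) ^ n / (2 * Real.pi) * Complex.exp (Complex.I * (n - 2 * k) * b),
    by fun_prop⟩

lemma zernikeWeight_apply (n k : ℕ) (b : ℝ) : zernikeWeight n k b =
    (-Complex.I) ^ n / (2 * Real.pi) * Complex.exp (Complex.I * (n - 2 * k) * b) := rfl

lemma zernikeWeight_periodic (n k : ℕ) :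
    Function.Periodic (zernikeWeight n k) (2 * Real.pi) := by
  intro b
  rw [zernikeWeight_apply, zernikeWeight_apply,
    show Complex.I * (n - 2 * k) * ((b + 2 * Real.pi : ℝ) : ℂ) = Complex.I * (n - 2 * k) * b +
      ((n - 2 * k : ℤ) : ℂ) * (2 * Real.pi * Complex.I) by push_cast; ring,
    Complex.exp_add, Complex.exp_int_mul_two_pi_mul_I, mul_one]

lemma zernikeWeight_add (n k : ℕ) (a b : ℝ) : zernikeWeight n k (a + b) =
    zernikeWeight n k b * Complex.exp (Complex.I * (n - 2 * k) * a) := by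
  rw [zernikeWeight_apply, zernikeWeight_apply, show Complex.I * (n - 2 * k) * ((a + b : ℝ) : ℂ) =
    Complex.I * (n - 2 * k) * b + Complex.I * (n - 2 * k) * a by push_cast; ring,
    Complex.exp_add]
  ring

/-- The Zernike functions as continuous functions. -/
def zernikeC (n k : ℕ) : C(ℂ, ℂ) := ridge (zernikeWeight n k) (U ℂ n)

/-- The factor `cos α` is the weight in Santaló's formula, and the rest depends only on the line,
through `b = β + α` and `s = sin α`. -/
lemma psiFun_eq (n k : ℕ) (p : ℝ × ℝ) : psiFun n k p =
    Real.cos p.2 * (zernikeWeight n k (p.1 + p.2) * (U ℂ n).eval (Real.sin p.2 : ℂ)) := by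
  have hπ : (Real.pi : ℂ) ≠ 0 := Complex.ofReal_ne_zero.2 Real.pi_ne_zero
  have h : (-1 : ℂ) ^ n * Complex.I ^ n = (-Complex.I) ^ n := by rw [← mul_pow]; simp
  rw [psiFun, ← two_mul_I_pow_mul_U_sin, zernikeWeight_apply, ← h]
  push_cast
  field_simp
  ring

/-- The ridge-polynomial form of `I₀*` on the functions `ψ_{n,k}`. -/
lemma zernike_eq_contL2 (n k : ℕ) : zernike n k = contL2 (zernikeC n k) := by
  refine ext_inner_right ℂ fun g => ?_
  -- Both sides are continuous in `g`, so by density `g` may be continuous on the plane, where the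
  -- weighted Santaló formula applies.
  refine congrFun (denseRange_contL2.equalizer (g := fun g => inner ℂ (zernike n k) g)
    (h := fun g => inner ℂ (contL2 (zernikeC n k)) g) (by fun_prop) (by fun_prop) ?_) g
  funext f
  simp only [Function.comp_apply]
  rw [zernike, I₀Star, ContinuousLinearMap.adjoint_inner_left, L2.inner_def, inner_contL2_left]
  set K : ℝ → ℝ → ℂ := fun b s =>
    starRingEnd ℂ (zernikeWeight n k b * (U ℂ n).eval (s : ℂ)) with hK
  have hcK : Continuous fun q : ℝ × ℝ => K q.1 q.2 := by
    simp only [hK]; fun_prop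
  have hper (s : ℝ) : Function.Periodic (fun b => K b s) (2 * Real.pi) := by
    intro b
    simp only [hK, zernikeWeight_periodic n k b]
  calc _ = ∫ p, (Real.cos p.2 * K (p.1 + p.2) (Real.sin p.2)) * xray f p ∂fanMeasure := by
        refine integral_congr_ae ?_
        filter_upwards [coeFn_I₀_contL2 f, MemLp.coeFn_toLp (memLp_psiFun n k)] with p h1 h2
        rw [RCLike.inner_apply, h1, psi, h2, psiFun_eq, map_mul, Complex.conj_ofReal, mul_comm]
    _ = _ := integral_fan_mul_xray K hcK hper f f.continuous
    _ = _ := by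
        refine integral_congr_ae ?_
        filter_upwards [coeFn_contL2 f] with z hz
        rw [hz]
        congr 1
        rw [zernikeC, ridge_apply, ridgeFun, intervalIntegral.intervalIntegral_eq_integral_uIoc,
          intervalIntegral.intervalIntegral_eq_integral_uIoc]
        simp only [hK, Complex.real_smul, map_mul, Complex.conj_ofReal, ← integral_conj]

/-- After exchanging the chord integral with the superposition, `integral_U_ridge` splits off
`U_n(s) cos α`. What remains is a Fourier coefficient of `U_n(cos δ)`, equal to `2π`, where `δ` is
the angle between ridge direction and chord. -/
lemma xray_zernikeC {n k : ℕ} (hk : k ≤ n) (p : ℝ × ℝ)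
    (hp : p.2 ∈ Ioo (-(Real.pi / 2)) (Real.pi / 2)) :
    xray (zernikeC n k) p = 4 * Real.pi / (n + 1) * psiFun n k p := by
  obtain ⟨b, a⟩ := p
  simp only at hp
  rw [xray_eq_chordIntegral _ _ hp, psiFun_eq, chordIntegral, sqrt_one_sub_sin_sq hp]
  simp only [zernikeC, ridge_apply, ridgeFun, lineCoord_chordPoint]
  set B := b + a with hB
  set φ := Real.pi / 2 - a with hφ
  have hs : Real.sin a = Real.cos φ := by rw [hφ, Real.cos_pi_div_two_sub]
  have hc : Real.cos a = Real.sin φ := by rw [hφ, Real.sin_pi_div_two_sub]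
  rw [hs, hc]
  have hcont : Continuous fun q : ℝ × ℝ => zernikeWeight n k q.2 * (U ℂ n).eval
      ((Real.cos φ * Real.cos (q.2 - B) - q.1 * Real.sin (q.2 - B) : ℝ) : ℂ) := by
    fun_prop
  have hper : Function.Periodic (fun b' => ∫ t in -Real.sin φ..Real.sin φ,
      zernikeWeight n k b' * (U ℂ n).eval
        ((Real.cos φ * Real.cos (b' - B) - t * Real.sin (b' - B) : ℝ) : ℂ)) (2 * Real.pi) := by
    intro b'
    simp only [zernikeWeight_periodic n k b', add_sub_right_comm, Real.cos_add_two_pi,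
      Real.sin_add_two_pi]
  rw [intervalIntegral_intervalIntegral_swap (F := fun t b' => zernikeWeight n k b' *
      (U ℂ n).eval ((Real.cos φ * Real.cos (b' - B) - t * Real.sin (b' - B) : ℝ) : ℂ))
      (IntegrableOn.mono_set (hcont.continuousOn.integrableOn_compact (isCompact_uIcc.prod isCompact_uIcc))
      (prod_mono uIoc_subset_uIcc uIoc_subset_uIcc)),
    ← periodic_integral_comp_add hper B]
  have hae : ∀ᵐ δ : ℝ, δ ∈ uIoc 0 (2 * Real.pi) → ∫ t in -Real.sin φ..Real.sin φ,
      zernikeWeight n k (δ + B) * (U ℂ n).eval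
        ((Real.cos φ * Real.cos (δ + B - B) - t * Real.sin (δ + B - B) : ℝ) : ℂ) =
      (zernikeWeight n k B * (2 / (n + 1) * ((U ℂ n).eval (Real.cos φ : ℂ) * Real.sin φ))) *
      (Complex.exp (Complex.I * (n - 2 * k) * δ) * (U ℂ n).eval (Real.cos δ : ℂ)) := by
    filter_upwards [ae_sin_ne_zero] with δ hδ _
    rw [intervalIntegral.integral_const_mul, add_sub_cancel_right, integral_U_ridge n φ δ hδ,
      zernikeWeight_add]
    ring
  rw [intervalIntegral.integral_congr_ae hae, intervalIntegral.integral_const_mul,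
    integral_exp_mul_U_cos hk]
  ring

/-- The eigenvalue `4π / (n + 1)` of `I₀* I₀` on the Zernike functions of degree `n`. -/
def eigenvalue (n : ℕ) : ℝ := 4 * Real.pi / (n + 1)

lemma eigenvalue_pos (n : ℕ) : 0 < eigenvalue n := by unfold eigenvalue; positivity

lemma I₀_zernike {n k : ℕ} (hk : k ≤ n) :
    I₀ (zernike n k) = (eigenvalue n : ℂ) • psi n k := by
  rw [zernike_eq_contL2]
  refine Lp.ext ?_
  filter_upwards [coeFn_I₀_contL2 (zernikeC n k), MemLp.coeFn_toLp (memLp_psiFun n k),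
    Lp.coeFn_smul (eigenvalue n : ℂ) (psi n k), ae_fan_cos_pos] with p h1 h2 h3 h4
  rw [h1, h3, Pi.smul_apply, psi, h2, xray_zernikeC hk p h4, eigenvalue, smul_eq_mul]
  push_cast
  rfl

lemma normalOp_zernike {n k : ℕ} (hk : k ≤ n) :
    normalOp (zernike n k) = (eigenvalue n : ℂ) • zernike n k := by
  rw [normalOp, ContinuousLinearMap.comp_apply, I₀_zernike hk, map_smul]
  rfl

lemma inner_zernike {n k m l : ℕ} (hl : l ≤ m) :
    inner ℂ (zernike n k) (zernike m l) = eigenvalue m * inner ℂ (psi n k) (psi m l) := by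
  conv_lhs => rw [zernike, I₀Star, ContinuousLinearMap.adjoint_inner_left, I₀_zernike hl,
    inner_smul_right]

/-- Moving `I₀*` across either side of `⟨Z_{n,k}, Z_{m,l}⟩` gives `⟨ψ_{n,k}, ψ_{m,l}⟩` times the
eigenvalue of `m` or that of `n`. These eigenvalues differ. -/
lemma inner_psi_of_ne {n k m l : ℕ} (hk : k ≤ n) (hl : l ≤ m) (h : n ≠ m) :
    inner ℂ (psi n k) (psi m l) = 0 := by
  have h1 := inner_zernike (n := n) (k := k) hl
  have h2 := congrArg (starRingEnd ℂ) (inner_zernike (n := m) (k := l) hk)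
  rw [map_mul, inner_conj_symm, inner_conj_symm, Complex.conj_ofReal, h1] at h2
  by_contra h0
  have h3 := Complex.ofReal_injective (mul_right_cancel₀ h0 h2)
  unfold eigenvalue at h3
  rw [div_eq_div_iff (by positivity) (by positivity)] at h3
  have h4 := mul_left_cancel₀ (by positivity : (4 * Real.pi : ℝ) ≠ 0) h3
  exact h (by exact_mod_cast add_right_cancel h4)

/-- The product of the two functions has frequency `2(k - l)` in `β + α`, so integration in `β`
leaves only `k = l`. The oscillating term `cos(2(n+1)α)` then has integral zero, and the constant is
`2 · π · 2π / (16π²)`. -/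
lemma inner_psi (n k l : ℕ) :
    inner ℂ (psi n k) (psi n l) = if k = l then 1 / 4 else 0 := by
  have hπ : (Real.pi : ℂ) ≠ 0 := Complex.ofReal_ne_zero.2 Real.pi_ne_zero
  have hconj (x : ℂ) (r : ℝ) (hx : x = Complex.I * r) :
      starRingEnd ℂ (Complex.exp x) = Complex.exp (-x) := by
    rw [← Complex.exp_conj, hx]; simp
  set G : ℝ × ℝ → ℂ := fun p => 1 / (16 * Real.pi ^ 2) *
    (2 + 2 * (-1) ^ n * (Real.cos (2 * (n + 1) * p.2) : ℂ)) *
      Complex.exp (Complex.I * ((2 * (k - l) : ℤ) : ℂ) * (p.1 + p.2 : ℝ)) with hG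
  have hprod (p : ℝ × ℝ) : psiFun n l p * starRingEnd ℂ (psiFun n k p) = G p := by
    simp only [psiFun, map_mul, map_add, map_div₀, map_pow, map_neg, map_one, Complex.conj_ofReal,
      map_ofNat, hG]
    rw [hconj _ ((n - 2 * k) * (p.1 + p.2)) (by push_cast; ring),
      hconj _ ((n + 1) * p.2) (by push_cast; ring), hconj _ (-((n + 1) * p.2)) (by push_cast; ring),
      neg_neg]
    have e1 : Complex.exp (Complex.I * ((2 * (k - l) : ℤ) : ℂ) * (p.1 + p.2 : ℝ)) =
        Complex.exp (Complex.I * (n - 2 * l) * (p.1 + p.2)) *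
          Complex.exp (-(Complex.I * (n - 2 * k) * (p.1 + p.2))) := by
      rw [← Complex.exp_add]; congr 1; push_cast; ring
    have e2 : 2 * (Real.cos (2 * (n + 1) * p.2) : ℂ) =
        Complex.exp (Complex.I * (n + 1) * p.2) ^ 2 +
          Complex.exp (-(Complex.I * (n + 1) * p.2)) ^ 2 := by
      rw [← Complex.exp_nat_mul, ← Complex.exp_nat_mul, Complex.ofReal_cos, Complex.cos]
      have a1 : ((2 * (n + 1) * p.2 : ℝ) : ℂ) * Complex.I =
          ((2 : ℕ) : ℂ) * (Complex.I * (n + 1) * p.2) := by push_cast; ring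
      rw [neg_mul, a1, mul_neg]
      ring
    have e3 : Complex.exp (Complex.I * (n + 1) * p.2) *
        Complex.exp (-(Complex.I * (n + 1) * p.2)) = 1 := by
      rw [← Complex.exp_add, add_neg_cancel, Complex.exp_zero]
    have e4 : ((-1 : ℂ) ^ n) ^ 2 = 1 := by rw [← pow_mul, mul_comm, pow_mul]; simp
    rw [e1, mul_right_comm 2, e2]
    set s := (-1 : ℂ) ^ n
    set E := Complex.exp (Complex.I * (n + 1) * p.2)
    set E' := Complex.exp (-(Complex.I * (n + 1) * p.2))
    set A := Complex.exp (Complex.I * (n - 2 * l) * (p.1 + p.2))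
    set A' := Complex.exp (-(Complex.I * (n - 2 * k) * (p.1 + p.2)))
    have key : s ^ 2 * ((E + s * E') * (E' + s * E)) = 2 + (E ^ 2 + E' ^ 2) * s := by
      rw [e4]
      linear_combination (1 + s ^ 2) * e3 + e4
    linear_combination (A * A' / (16 * Real.pi ^ 2)) * key
  have hcG : Continuous G := by simp only [hG]; fun_prop
  rw [L2.inner_def]
  have h1 : ∫ p, inner ℂ (psi n k p) (psi n l p) ∂fanMeasure = ∫ p, G p ∂fanMeasure := by
    refine integral_congr_ae ?_
    filter_upwards [MemLp.coeFn_toLp (memLp_psiFun n k),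
      MemLp.coeFn_toLp (memLp_psiFun n l)] with p h1 h2
    rw [psi, psi, h1, h2, RCLike.inner_apply, hprod]
  rw [h1, integral_fan_eq G hcG]
  have hβ (a : ℝ) : ∫ b in (0 : ℝ)..(2 * Real.pi), G (b, a) =
      1 / (16 * Real.pi ^ 2) * (2 + 2 * (-1) ^ n * (Real.cos (2 * (n + 1) * a) : ℂ)) *
        (if k = l then 2 * (Real.pi : ℂ) else 0) := by
    have hper : Function.Periodic (fun b : ℝ =>
        Complex.exp (Complex.I * ((2 * (k - l) : ℤ) : ℂ) * b)) (2 * Real.pi) := by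
      intro b
      simp only
      rw [show Complex.I * ((2 * (k - l) : ℤ) : ℂ) * ((b + 2 * Real.pi : ℝ) : ℂ) =
        Complex.I * ((2 * (k - l) : ℤ) : ℂ) * b +
        ((2 * (k - l) : ℤ) : ℂ) * (2 * Real.pi * Complex.I) by push_cast; ring,
        Complex.exp_add, Complex.exp_int_mul_two_pi_mul_I, mul_one]
    simp only [hG]
    rw [intervalIntegral.integral_const_mul, periodic_integral_comp_add hper a,
      integral_exp_int_mul]
    congr 1
    by_cases h : k = l
    · rw [if_pos (by omega), if_pos h]
    · rw [if_neg (by omega), if_neg h]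
  simp_rw [hβ]
  rw [intervalIntegral.integral_mul_const, intervalIntegral.integral_const_mul,
    intervalIntegral.integral_add (Continuous.intervalIntegrable (by fun_prop) _ _)
      (Continuous.intervalIntegrable (by fun_prop) _ _), intervalIntegral.integral_const,
    intervalIntegral.integral_const_mul, intervalIntegral.integral_ofReal]
  have hcos : ∫ a in -(Real.pi / 2)..(Real.pi / 2), Real.cos (2 * (n + 1) * a) = 0 := by
    rw [intervalIntegral.integral_comp_mul_left (fun x => Real.cos x) (by positivity),
      integral_cos,
      show 2 * ((n : ℝ) + 1) * (Real.pi / 2) = ((n + 1 : ℕ) : ℝ) * Real.pi by push_cast; ring,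
      show 2 * ((n : ℝ) + 1) * -(Real.pi / 2) = -(((n + 1 : ℕ) : ℝ) * Real.pi) by
        push_cast; ring, Real.sin_neg, Real.sin_nat_mul_pi]
    simp
  rw [hcos]
  split_ifs with h
  · rw [Complex.real_smul]
    push_cast
    field_simp
    ring
  · simp

/-! ### The Zernike basis -/

lemma inner_zernike_of_ne {i j : Σ n : ℕ, Fin (n + 1)} (h : i ≠ j) :
    inner ℂ (zernike i.1 i.2) (zernike j.1 j.2) = 0 := by
  obtain ⟨n, k⟩ := i
  obtain ⟨m, l⟩ := j
  rw [inner_zernike (Nat.lt_succ_iff.1 l.2)]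
  by_cases hnm : n = m
  · subst hnm
    have hkl : (k : ℕ) ≠ l := fun h' => h (by rw [Fin.ext h'])
    rw [inner_psi, if_neg hkl, mul_zero]
  · rw [inner_psi_of_ne (Nat.lt_succ_iff.1 k.2) (Nat.lt_succ_iff.1 l.2) hnm, mul_zero]

lemma norm_zernike_sq {n k : ℕ} (hk : k ≤ n) : ‖zernike n k‖ ^ 2 = Real.pi / (n + 1) := by
  have h := inner_self_eq_norm_sq_to_K (𝕜 := ℂ) (zernike n k)
  rw [inner_zernike hk, inner_psi, if_pos rfl] at h
  have h2 : ((‖zernike n k‖ ^ 2 : ℝ) : ℂ) = ((eigenvalue n * (1 / 4) : ℝ) : ℂ) := by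
    push_cast
    exact h.symm
  rw [Complex.ofReal_injective h2, eigenvalue]
  ring

lemma norm_zernike_pos {n k : ℕ} (hk : k ≤ n) : 0 < ‖zernike n k‖ := by
  have h := norm_zernike_sq hk
  have h2 : (0 : ℝ) < Real.pi / (n + 1) := by positivity
  refine (norm_nonneg _).lt_of_ne fun h0 => ?_
  rw [← h, ← h0] at h2
  simp at h2

lemma zernikeHat_orthonormal :
    Orthonormal ℂ fun i : Σ n : ℕ, Fin (n + 1) => zernikeHat i.1 i.2 := by
  refine ⟨fun i => ?_, fun i j h => ?_⟩
  · have := norm_zernike_pos (Nat.lt_succ_iff.1 i.2.2)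
    change ‖zernikeHat i.1 i.2‖ = 1
    rw [zernikeHat, norm_smul, Complex.norm_real, norm_inv, norm_norm, inv_mul_cancel₀ this.ne']
  · simp only [zernikeHat, inner_smul_left, inner_smul_right, inner_zernike_of_ne h, mul_zero]

lemma zernike_eq_smul_hat {n k : ℕ} (hk : k ≤ n) :
    zernike n k = ((‖zernike n k‖ : ℝ) : ℂ) • zernikeHat n k := by
  rw [zernikeHat, smul_smul, ← Complex.ofReal_mul, mul_inv_cancel₀ (norm_zernike_pos hk).ne',
    Complex.ofReal_one, one_smul]

/-- The monomial `xᵃ yᵇ` in the real coordinates of the plane. -/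
def coordMonomial (a b : ℕ) : C(ℂ, ℂ) :=
  ⟨fun z => (z.re : ℂ) ^ a * (z.im : ℂ) ^ b, by fun_prop⟩

lemma zernikeC_mem_span (N : ℕ) {n k : ℕ} (hn : n ≤ N) : zernikeC n k ∈ Submodule.span ℂ
    (range fun i : Σ j : Fin (N + 1), Fin (j + 1) => coordMonomial i.2 (i.1 - i.2)) := by
  have hdeg : (U ℂ n).natDegree ≤ N := by
    rw [Chebyshev.natDegree_U_natCast]; exact hn
  obtain ⟨c, hc⟩ := ridgeFun_eq_sum (zernikeWeight n k) (U ℂ n) N hdeg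
  have h : zernikeC n k = ∑ j ∈ Finset.range (N + 1), ∑ l ∈ Finset.range (j + 1),
      c j l • coordMonomial l (j - l) := by
    ext z
    rw [zernikeC, ridge_apply, hc, ContinuousMap.sum_apply]
    refine Finset.sum_congr rfl fun j _ => ?_
    rw [ContinuousMap.sum_apply]
    rfl
  rw [h]
  refine Submodule.sum_mem _ fun j hj => Submodule.sum_mem _ fun l hl =>
    Submodule.smul_mem _ _ (Submodule.subset_span ?_)
  exact ⟨⟨⟨j, Finset.mem_range.1 hj⟩, ⟨l, Finset.mem_range.1 hl⟩⟩, rfl⟩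

/-- Every polynomial function is a combination of Zernike functions. -/
lemma contL2_coordMonomial_mem_span (a b : ℕ) : contL2 (coordMonomial a b) ∈
    Submodule.span ℂ (range fun i : Σ n : ℕ, Fin (n + 1) => zernike i.1 i.2) := by
  set N := a + b with hN
  set v : (Σ j : Fin (N + 1), Fin (j + 1)) → L2Disk := fun i => zernike i.1 i.2 with hv
  set m : (Σ j : Fin (N + 1), Fin (j + 1)) → L2Disk :=
    fun i => contL2 (coordMonomial i.2 (i.1 - i.2)) with hm
  have hle : Submodule.span ℂ (range v) ≤ Submodule.span ℂ (range m) := by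
    rw [Submodule.span_le]
    rintro _ ⟨i, rfl⟩
    have h := Submodule.mem_map_of_mem (f := contL2)
      (zernikeC_mem_span N (k := i.2) (Nat.lt_succ_iff.1 i.1.2))
    rw [Submodule.map_span, ← range_comp] at h
    simp only [hv, zernike_eq_contL2]
    exact h
  have hli : LinearIndependent ℂ v := by
    refine linearIndependent_of_ne_zero_of_inner_eq_zero (fun i => ?_) fun i j hij => ?_
    · exact norm_pos_iff.1 (norm_zernike_pos (Nat.lt_succ_iff.1 i.2.2))
    · refine inner_zernike_of_ne (i := ⟨i.1, i.2⟩) (j := ⟨j.1, j.2⟩) fun h => hij ?_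
      obtain ⟨⟨i₁, _⟩, i₂⟩ := i
      obtain ⟨⟨j₁, _⟩, j₂⟩ := j
      simp only [Sigma.mk.injEq] at h
      obtain ⟨rfl, h⟩ := h
      rw [eq_of_heq h]
  have hfin := FiniteDimensional.span_of_finite ℂ (finite_range m)
  -- The Zernike functions and the monomials of degree at most `N` have the same index set. The
  -- former are independent by orthogonality, so the inclusion of spans is an equality.
  have heq := Submodule.eq_of_le_of_finrank_le hle (by
    rw [finrank_span_eq_card hli]
    exact finrank_range_le_card m)
  have hmem : contL2 (coordMonomial a b) ∈ Submodule.span ℂ (range m) := by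
    refine Submodule.subset_span ⟨⟨⟨N, Nat.lt_succ_self N⟩, ⟨a, by simp only; omega⟩⟩, ?_⟩
    simp [hm, hN]
  rw [← heq] at hmem
  refine Submodule.span_mono ?_ hmem
  rintro _ ⟨i, rfl⟩
  exact ⟨⟨i.1, i.2⟩, rfl⟩

/-! ### Completeness of the Zernike functions by Stone-Weierstrass -/

/-- The polynomial functions in the real coordinates of the plane. -/
def coordPolynomials : Submodule ℂ C(ℂ, ℂ) :=
  Submodule.span ℂ (range fun q : ℕ × ℕ => coordMonomial q.1 q.2)

lemma coordMonomial_mem (a b : ℕ) : coordMonomial a b ∈ coordPolynomials :=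
  Submodule.subset_span ⟨(a, b), rfl⟩

lemma coordPolynomials_mul {f g : C(ℂ, ℂ)} (hf : f ∈ coordPolynomials)
    (hg : g ∈ coordPolynomials) : f * g ∈ coordPolynomials := by
  have h := Submodule.mul_mem_mul hf hg
  rw [coordPolynomials, Submodule.span_mul_span] at h
  refine Submodule.span_mono ?_ h
  rintro _ ⟨_, ⟨p, rfl⟩, _, ⟨q, rfl⟩, rfl⟩
  refine ⟨(p.1 + q.1, p.2 + q.2), ?_⟩
  ext z
  simp only [coordMonomial, ContinuousMap.coe_mk, ContinuousMap.mul_apply, pow_add]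
  ring

lemma coordPolynomials_algebraMap (c : ℂ) : algebraMap ℂ C(ℂ, ℂ) c ∈ coordPolynomials := by
  have : algebraMap ℂ C(ℂ, ℂ) c = c • coordMonomial 0 0 := by
    ext z
    simp [coordMonomial]
  rw [this]
  exact Submodule.smul_mem _ _ (coordMonomial_mem 0 0)

lemma coordPolynomials_star {f : C(ℂ, ℂ)} (hf : f ∈ coordPolynomials) :
    star f ∈ coordPolynomials := by
  induction hf using Submodule.span_induction with
  | mem f hf =>
    obtain ⟨q, rfl⟩ := hf
    have : star (coordMonomial q.1 q.2) = coordMonomial q.1 q.2 := by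
      ext z
      simp [coordMonomial]
    rw [this]
    exact coordMonomial_mem _ _
  | zero => simp
  | add f g _ _ hf hg => rw [star_add]; exact Submodule.add_mem _ hf hg
  | smul c f _ hf => rw [star_smul]; exact Submodule.smul_mem _ _ hf

/-- The restrictions of the polynomial functions to the disk. -/
def diskPolynomials : StarSubalgebra ℂ C(Metric.closedBall (0 : ℂ) 1, ℂ) where
  carrier := {q | ∃ f ∈ coordPolynomials, ∀ z, q z = f z}
  mul_mem' := by
    rintro _ _ ⟨f, hf, h⟩ ⟨g, hg, h'⟩
    exact ⟨f * g, coordPolynomials_mul hf hg, fun z => by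
      rw [ContinuousMap.mul_apply, h, h', ContinuousMap.mul_apply]⟩
  add_mem' := by
    rintro _ _ ⟨f, hf, h⟩ ⟨g, hg, h'⟩
    exact ⟨f + g, Submodule.add_mem _ hf hg, fun z => by
      rw [ContinuousMap.add_apply, h, h', ContinuousMap.add_apply]⟩
  algebraMap_mem' c := ⟨_, coordPolynomials_algebraMap c, fun z => rfl⟩
  star_mem' := by
    rintro _ ⟨f, hf, h⟩
    exact ⟨star f, coordPolynomials_star hf, fun z => by
      rw [ContinuousMap.star_apply, h, ContinuousMap.star_apply]⟩

lemma diskPolynomials_dense : diskPolynomials.topologicalClosure = ⊤ := by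
  refine ContinuousMap.starSubalgebra_topologicalClosure_eq_top_of_separatesPoints _ ?_
  intro x y hxy
  refine ⟨fun z => z, ⟨⟨fun z => z, continuous_subtype_val⟩, ?_, rfl⟩, fun h => hxy (Subtype.ext h)⟩
  -- The identity function `z = x + iy` is itself a polynomial function and separates points.
  refine ⟨coordMonomial 1 0 + Complex.I • coordMonomial 0 1,
    Submodule.add_mem _ (coordMonomial_mem _ _)
      (Submodule.smul_mem _ _ (coordMonomial_mem _ _)), fun z => ?_⟩
  have := Complex.re_add_im (z : ℂ)
  simp only [coordMonomial, ContinuousMap.add_apply, ContinuousMap.smul_apply,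
    ContinuousMap.coe_mk, pow_one, pow_zero, mul_one, one_mul, smul_eq_mul]
  rw [mul_comm, this]

lemma norm_contL2_le (f : C(ℂ, ℂ)) (C : ℝ) (hC : 0 ≤ C)
    (h : ∀ z ∈ Metric.closedBall (0 : ℂ) 1, ‖f z‖ ≤ C) :
    ‖contL2 f‖ ≤ diskMeasure.real univ ^ ((2 : ℝ≥0∞).toReal⁻¹) * C := by
  refine Lp.norm_le_of_ae_bound hC ?_
  filter_upwards [coeFn_contL2 f, ae_disk_mem_closedBall] with z h1 h2
  rw [h1]
  exact h z h2

/-- The Zernike functions are complete in `L²(D)`. -/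
lemma eq_zero_of_forall_inner_zernike {f : L2Disk}
    (h : ∀ i : Σ n : ℕ, Fin (n + 1), inner ℂ (zernike i.1 i.2) f = 0) : f = 0 := by
  have hspan (K : Submodule ℂ L2Disk) (s : Set L2Disk) (hK : K = Submodule.span ℂ s)
      (hs : ∀ v ∈ s, inner ℂ v f = 0) (v : L2Disk) (hv : v ∈ K) : inner ℂ v f = 0 := by
    subst hK
    induction hv using Submodule.span_induction with
    | mem v hv => exact hs v hv
    | zero => exact inner_zero_left _
    | add v w _ _ hv hw => rw [inner_add_left, hv, hw, add_zero]
    | smul c v _ hv => rw [inner_smul_left, hv, mul_zero]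
  have hmono (a b : ℕ) : inner ℂ (contL2 (coordMonomial a b)) f = 0 :=
    hspan _ _ rfl (by rintro _ ⟨i, rfl⟩; exact h i) _ (contL2_coordMonomial_mem_span a b)
  have hpoly (g : C(ℂ, ℂ)) (hg : g ∈ coordPolynomials) : inner ℂ (contL2 g) f = 0 := by
    refine hspan (coordPolynomials.map contL2) (contL2 '' range fun q : ℕ × ℕ =>
      coordMonomial q.1 q.2) (Submodule.map_span _ _) ?_ _ (Submodule.mem_map_of_mem hg)
    rintro _ ⟨_, ⟨q, rfl⟩, rfl⟩
    exact hmono _ _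
  have hcont (g : C(ℂ, ℂ)) : inner ℂ (contL2 g) f = 0 := by
    set M := diskMeasure.real univ ^ ((2 : ℝ≥0∞).toReal⁻¹) with hM
    have hM0 : 0 ≤ M := by positivity
    have hbound : ∀ ε > 0, ‖(inner ℂ (contL2 g) f : ℂ)‖ ≤ M * ε * ‖f‖ := by
      intro ε hε
      have hmem : g.restrict (Metric.closedBall (0 : ℂ) 1) ∈ closure
          (diskPolynomials : Set C(Metric.closedBall (0 : ℂ) 1, ℂ)) := by
        rw [← StarSubalgebra.topologicalClosure_coe, diskPolynomials_dense]
        exact mem_univ _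
      obtain ⟨q, ⟨Q, hQ, hqQ⟩, hd⟩ := Metric.mem_closure_iff.1 hmem ε hε
      -- `f` is orthogonal to polynomials, so only the error `g - Q`, of size below `ε` on the disk,
      -- contributes.
      have hinner : inner ℂ (contL2 g) f = inner ℂ (contL2 (g - Q)) f := by
        rw [map_sub, inner_sub_left, hpoly Q hQ, sub_zero]
      rw [hinner]
      refine (norm_inner_le_norm _ _).trans ?_
      refine mul_le_mul_of_nonneg_right (norm_contL2_le _ ε hε.le fun z hz => ?_) (norm_nonneg _)
      have := (ContinuousMap.dist_lt_iff hε).1 hd ⟨z, hz⟩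
      rw [hqQ, dist_eq_norm] at this
      exact this.le
    have hlim : Tendsto (fun ε : ℝ => M * ε * ‖f‖) (𝓝[>] 0) (𝓝 0) := by
      have : Continuous fun ε : ℝ => M * ε * ‖f‖ := by fun_prop
      simpa using (this.tendsto 0).mono_left nhdsWithin_le_nhds
    exact norm_le_zero_iff.1 (ge_of_tendsto hlim (by
      filter_upwards [self_mem_nhdsWithin] with ε hε using hbound ε hε))
  refine ext_inner_left ℂ fun v => ?_
  rw [inner_zero_right]
  exact congrFun (denseRange_contL2.equalizer (g := fun v => inner ℂ v f)
    (h := fun _ => (0 : ℂ)) (by fun_prop) (by fun_prop) (funext hcont)) v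

/-- The normalized Zernike functions form a Hilbert basis of `L²(D)`. -/
def zernikeBasis : HilbertBasis (Σ n : ℕ, Fin (n + 1)) ℂ L2Disk :=
  HilbertBasis.mkOfOrthogonalEqBot zernikeHat_orthonormal (by
    rw [Submodule.eq_bot_iff]
    intro f hf
    refine eq_zero_of_forall_inner_zernike fun i => ?_
    rw [zernike_eq_smul_hat (Nat.lt_succ_iff.1 i.2.2), inner_smul_left,
      (Submodule.mem_orthogonal _ _).1 hf _ (Submodule.subset_span ⟨i, rfl⟩), mul_zero])

lemma zernikeBasis_apply (i : Σ n : ℕ, Fin (n + 1)) : zernikeBasis i = zernikeHat i.1 i.2 :=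
  congrFun (HilbertBasis.coe_mkOfOrthogonalEqBot _ _) i

lemma hasSum_zernikeHat (f : L2Disk) : HasSum (fun i : Σ n : ℕ, Fin (n + 1) =>
    inner ℂ (zernikeHat i.1 i.2) f • zernikeHat i.1 i.2) f := by
  have h := zernikeBasis.hasSum_repr f
  simpa only [HilbertBasis.repr_apply_apply, zernikeBasis_apply] using h

/-! ### The range of the normal operator -/

lemma normalOp_zernikeHat (i : Σ n : ℕ, Fin (n + 1)) :
    normalOp (zernikeHat i.1 i.2) = (eigenvalue i.1 : ℂ) • zernikeHat i.1 i.2 := by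
  rw [zernikeHat, map_smul, normalOp_zernike (Nat.lt_succ_iff.1 i.2.2), smul_comm]

lemma rpow_two_mul_one (n : ℕ) : ((n : ℝ) + 1) ^ (2 * (1 : ℝ)) = ((n : ℝ) + 1) ^ 2 := by
  rw [mul_one]; exact Real.rpow_two _

lemma mul_eigenvalue_sq (n : ℕ) :
    ((n : ℝ) + 1) ^ 2 * eigenvalue n ^ 2 = (4 * Real.pi) ^ 2 := by
  have : (n : ℝ) + 1 ≠ 0 := by positivity
  unfold eigenvalue
  field_simp

/-- In the Zernike basis the operator multiplies the coefficients of degree `n` by `4π/(n+1)`. A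
coefficient family is thus an image of a square-summable one exactly when it stays square-summable
after multiplication by `n + 1`. -/
lemma range_normalOp : range normalOp = Htilde 1 := by
  ext g
  constructor
  · rintro ⟨f, rfl⟩
    refine ⟨fun i => eigenvalue i.1 * inner ℂ (zernikeHat i.1 i.2) f, ?_, ?_⟩
    · have h := (hasSum_zernikeHat f).mapL normalOp
      simp only [map_smul, normalOp_zernikeHat, smul_smul] at h
      simpa only [mul_comm] using h
    · have h := (zernikeHat_orthonormal.inner_products_summable f).mul_left ((4 * Real.pi) ^ 2)
      refine h.congr fun i => ?_
      rw [rpow_two_mul_one, norm_mul, Complex.norm_real, Real.norm_of_nonneg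
        (eigenvalue_pos _).le]
      linear_combination -‖inner ℂ (zernikeHat i.1 i.2) f‖ ^ 2 * mul_eigenvalue_sq i.1
  · rintro ⟨c, hc, hs⟩
    set d : (Σ n : ℕ, Fin (n + 1)) → ℂ := fun i => (eigenvalue i.1 : ℂ)⁻¹ * c i with hd
    have hne (n : ℕ) : (eigenvalue n : ℂ) ≠ 0 := Complex.ofReal_ne_zero.2 (eigenvalue_pos n).ne'
    have hmem : Memℓp d 2 := by
      refine memℓp_gen ?_
      refine (hs.mul_left ((4 * Real.pi) ^ 2)⁻¹).congr fun i => ?_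
      rw [rpow_two_mul_one, ENNReal.toReal_ofNat, Real.rpow_two, hd]
      simp only
      rw [norm_mul, norm_inv, Complex.norm_real, Real.norm_of_nonneg (eigenvalue_pos _).le,
        ← mul_eigenvalue_sq i.1]
      have h1 : (i.1 : ℝ) + 1 ≠ 0 := by positivity
      have h2 := (eigenvalue_pos i.1).ne'
      field_simp
    have h := (zernikeBasis.hasSum_repr_symm ⟨d, hmem⟩).mapL normalOp
    refine ⟨zernikeBasis.repr.symm ⟨d, hmem⟩, ?_⟩
    refine h.unique ?_
    refine hc.congr_fun fun i => ?_
    change normalOp (d i • zernikeBasis i) = _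
    rw [zernikeBasis_apply, map_smul, normalOp_zernikeHat, smul_smul, hd]
    simp only
    rw [mul_right_comm, inv_mul_cancel₀ (hne _), one_mul]

/-! ### Derivatives of the Zernike functions -/

/-- The partial derivative `∂ₓ` of a Zernike function. -/
def zernikeDx (n k : ℕ) : C(ℂ, ℂ) := ridge (zernikeWeight n k * sinC) (derivative (U ℂ n))

/-- The partial derivative `∂_y` of a Zernike function. -/
def zernikeDy (n k : ℕ) : C(ℂ, ℂ) := -ridge (zernikeWeight n k * cosC) (derivative (U ℂ n))

/-- The Euler derivative `x ∂ₓ + y ∂_y` of a Zernike function. -/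
def zernikeEuler (n k : ℕ) : C(ℂ, ℂ) := ridge (zernikeWeight n k) (X * derivative (U ℂ n))

lemma contDiff_ridge (w : C(ℝ, ℂ)) (p : ℂ[X]) : ContDiff ℝ ∞ (ridge w p) := contDiff_ridgeFun w p

lemma fderiv_ridge (w : C(ℝ, ℂ)) (p : ℂ[X]) (z e : ℂ) : fderiv ℝ (ridge w p) z e =
    e.re * ridgeFun (w * sinC) p.derivative z - e.im * ridgeFun (w * cosC) p.derivative z :=
  fderiv_ridgeFun w p z e

lemma fderiv_zernikeC_one (n k : ℕ) (z : ℂ) :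
    fderiv ℝ (zernikeC n k) z 1 = zernikeDx n k z := by
  rw [zernikeC, fderiv_ridge]
  simp [zernikeDx, ridge_apply]

lemma fderiv_zernikeC_I (n k : ℕ) (z : ℂ) :
    fderiv ℝ (zernikeC n k) z Complex.I = zernikeDy n k z := by
  rw [zernikeC, fderiv_ridge]
  simp [zernikeDy, ridge_apply]

lemma isWeakGradient_zernike (n k : ℕ) :
    IsWeakGradient (zernike n k) (contL2 (zernikeDx n k)) (contL2 (zernikeDy n k)) := by
  rw [zernike_eq_contL2]
  exact ⟨isWeakDeriv_contL2 1 _ _ (contDiff_ridge _ _) (fderiv_zernikeC_one n k),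
    isWeakDeriv_contL2 Complex.I _ _ (contDiff_ridge _ _) (fderiv_zernikeC_I n k)⟩

lemma IsWeakGradient.add {u v ux uy vx vy : L2Disk} (hu : IsWeakGradient u ux uy)
    (hv : IsWeakGradient v vx vy) : IsWeakGradient (u + v) (ux + vx) (uy + vy) :=
  ⟨hu.1.add hv.1, hu.2.add hv.2⟩

lemma IsWeakGradient.smul {u ux uy : L2Disk} (c : ℂ) (hu : IsWeakGradient u ux uy) :
    IsWeakGradient (c • u) (c • ux) (c • uy) :=
  ⟨hu.1.smul c, hu.2.smul c⟩

lemma IsWeakGradient.zero : IsWeakGradient 0 0 0 := by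
  simpa using (isWeakGradient_zernike 0 0).smul 0

lemma IsWeakGradient.sum {ι : Type*} (s : Finset ι) {u ux uy : ι → L2Disk}
    (h : ∀ i, IsWeakGradient (u i) (ux i) (uy i)) :
    IsWeakGradient (∑ i ∈ s, u i) (∑ i ∈ s, ux i) (∑ i ∈ s, uy i) := by
  classical
  induction s using Finset.induction_on with
  | empty => simpa using IsWeakGradient.zero
  | insert a s ha ih =>
    simp only [Finset.sum_insert ha]
    exact (h a).add ih

lemma zernike_euler (n k : ℕ) (z : ℂ) :
    z.re * zernikeDx n k z + z.im * zernikeDy n k z = zernikeEuler n k z := by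
  rw [zernikeEuler, ridge_apply, ← ridgeFun_euler, zernikeDx, zernikeDy, ContinuousMap.neg_apply,
    ridge_apply, ridge_apply]
  ring

/-- The abscissa as a complex-valued function. -/
def reC : C(ℂ, ℂ) := ⟨fun z => (z.re : ℂ), by fun_prop⟩

/-- The ordinate as a complex-valued function. -/
def imC : C(ℂ, ℂ) := ⟨fun z => (z.im : ℂ), by fun_prop⟩

lemma reC_apply (z : ℂ) : reC z = (z.re : ℂ) := rfl

lemma imC_apply (z : ℂ) : imC z = (z.im : ℂ) := rfl

/-- First component of the flux `∇Z - x (x · ∇Z)` of a Zernike function. -/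
def fluxX (n k : ℕ) : C(ℂ, ℂ) := zernikeDx n k - reC * zernikeEuler n k

/-- Second component of the flux `∇Z - x (x · ∇Z)` of a Zernike function. -/
def fluxY (n k : ℕ) : C(ℂ, ℂ) := zernikeDy n k - imC * zernikeEuler n k

lemma contDiff_fluxX (n k : ℕ) : ContDiff ℝ ∞ (fluxX n k) :=
  (contDiff_ridge _ _).sub (contDiff_re.mul (contDiff_ridge _ _))

lemma contDiff_fluxY (n k : ℕ) : ContDiff ℝ ∞ (fluxY n k) :=
  (contDiff_ridge _ _).neg.sub (contDiff_im.mul (contDiff_ridge _ _))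

/-- With `p` a second derivative, this says that the Laplacian acts on ridge superpositions as the
second derivative of the profile. -/
lemma ridgeFun_sin_sq_add_cos_sq (w : C(ℝ, ℂ)) (p : ℂ[X]) (z : ℂ) :
    ridgeFun (w * sinC * sinC) p z + ridgeFun (w * cosC * cosC) p z = ridgeFun w p z := by
  rw [← ridgeFun_add_left]
  congr 1
  ext b
  simp only [ContinuousMap.add_apply, ContinuousMap.mul_apply, sinC_apply, cosC_apply]
  have h : (Real.sin b : ℂ) ^ 2 + (Real.cos b : ℂ) ^ 2 = 1 := by
    exact_mod_cast Real.sin_sq_add_cos_sq b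
  linear_combination w b * h

/-- The Zernike equation `-div (∇Z - x (x · ∇Z)) = n (n + 2) Z`. -/
lemma div_flux (n k : ℕ) (z : ℂ) :
    fderiv ℝ (fluxX n k) z 1 + fderiv ℝ (fluxY n k) z Complex.I =
      -(n * (n + 2)) * zernikeC n k z := by
  have hd (w : C(ℝ, ℂ)) (p : ℂ[X]) : HasFDerivAt (ridge w p) (fderiv ℝ (ridge w p) z) z :=
    (differentiable_of_smooth (contDiff_ridge w p) z).hasFDerivAt
  have hre : HasFDerivAt (reC : ℂ → ℂ) (Complex.ofRealCLM.comp Complex.reCLM) z :=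
    (Complex.ofRealCLM.comp Complex.reCLM).hasFDerivAt
  have him : HasFDerivAt (imC : ℂ → ℂ) (Complex.ofRealCLM.comp Complex.imCLM) z :=
    (Complex.ofRealCLM.comp Complex.imCLM).hasFDerivAt
  set w := zernikeWeight n k with hw
  set p := U ℂ n with hp
  have h1 : HasFDerivAt (fluxX n k) _ z :=
    (hd (w * sinC) (derivative p)).sub (hre.mul (hd w (X * derivative p)))
  have h2 : HasFDerivAt (fluxY n k) _ z :=
    (hd (w * cosC) (derivative p)).neg.sub (him.mul (hd w (X * derivative p)))
  -- The Chebyshev equation `(1 - X²)U'' - 3X U' + n(n+2) U = 0`, arranged to match `ΔZ - 2E - x·∇E`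
  -- with `E = x·∇Z`.
  have hpoly : derivative (derivative p) + (C (-2) * (X * derivative p) +
      C (-1) * (X * derivative (X * derivative p))) = C (-(n * (n + 2) : ℂ)) * p := by
    have h := Chebyshev.one_sub_X_sq_mul_derivative_derivative_U_eq_poly_in_U (R := ℂ) n
    rw [Function.iterate_succ, Function.iterate_one, Function.comp_apply, ← hp] at h
    simp only [derivative_mul, derivative_X, C_neg, C_mul, C_add, map_ofNat, map_natCast, C_1]
    push_cast at h
    linear_combination h
  have hev := congrArg (fun q => ridgeFun w q z) hpoly
  simp only [ridgeFun_add_right, ridgeFun_C_mul_right] at hev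
  rw [← ridgeFun_sin_sq_add_cos_sq w (derivative (derivative p)),
    ← ridgeFun_euler w (derivative (X * derivative p))] at hev
  rw [h1.fderiv, h2.fderiv]
  simp only [_root_.sub_apply, _root_.add_apply,
    _root_.neg_apply, _root_.smul_apply, fderiv_ridge,
    ContinuousLinearMap.comp_apply, Complex.reCLM_apply, Complex.imCLM_apply,
    Complex.ofRealCLM_apply, Complex.one_re, Complex.one_im, Complex.I_re, Complex.I_im,
    Complex.ofReal_zero, Complex.ofReal_one, smul_eq_mul, reC_apply, imC_apply]
  rw [zernikeC, zernikeEuler, ridge_apply, ridge_apply]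
  linear_combination hev

/-! ### Green's formula, the energy inequality and the inclusion of `H1` in the Zernike scale -/

lemma fderiv_conj {F : ℂ → ℂ} {z : ℂ} (hF : DifferentiableAt ℝ F z) (e : ℂ) :
    fderiv ℝ (fun z => starRingEnd ℂ (F z)) z e = starRingEnd ℂ (fderiv ℝ F z e) := by
  have h : HasFDerivAt (fun z => starRingEnd ℂ (F z)) _ z :=
    (Complex.conjCLE : ℂ →L[ℝ] ℂ).hasFDerivAt.comp z hF.hasFDerivAt
  rw [h.fderiv]
  rfl

/-- Green's formula for a function of `H¹(D)` and a Zernike function. -/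
lemma IsWeakGradient.inner_flux {u gx gy : L2Disk} (h : IsWeakGradient u gx gy) (n k : ℕ) :
    inner ℂ (contL2 (fluxX n k)) gx + inner ℂ (contL2 (fluxY n k)) gy =
      n * (n + 2) * inner ℂ (zernike n k) u := by
  have hsm {F : ℂ → ℂ} (hF : ContDiff ℝ ∞ F) : ContDiff ℝ ∞ fun z => starRingEnd ℂ (F z) :=
    (Complex.conjCLE : ℂ →L[ℝ] ℂ).contDiff.comp hF
  have key := h.integral_eq_of_tangent (fun z => starRingEnd ℂ (fluxX n k z))
    (fun z => starRingEnd ℂ (fluxY n k z)) (fun z => starRingEnd ℂ (zernikeEuler n k z))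
    (hsm (contDiff_fluxX n k)) (hsm (contDiff_fluxY n k))
    (Complex.continuous_conj.comp (zernikeEuler n k).continuous) (fun z => by
      have e := zernike_euler n k z
      -- The radial component of the flux is `(1 - |z|²) x·∇Z`, which vanishes on the circle; this
      -- is the tangency needed for integration by parts.
      have : z.re * fluxX n k z + z.im * fluxY n k z =
          (1 - ((z.re : ℂ) ^ 2 + (z.im : ℂ) ^ 2)) * zernikeEuler n k z := by
        simp only [fluxX, fluxY, ContinuousMap.sub_apply, ContinuousMap.mul_apply, reC_apply,
          imC_apply]
        linear_combination e
      have := congrArg (starRingEnd ℂ) this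
      simpa only [map_add, map_sub, map_mul, map_pow, map_one, Complex.conj_ofReal] using this)
  rw [inner_contL2_left, inner_contL2_left, key, zernike_eq_contL2, inner_contL2_left,
    ← integral_const_mul, ← integral_neg]
  congr 1 with z
  rw [fderiv_conj (differentiable_of_smooth (contDiff_fluxX n k) z),
    fderiv_conj (differentiable_of_smooth (contDiff_fluxY n k) z), ← map_add, div_flux]
  simp only [map_mul, map_neg, map_add, map_natCast, map_ofNat]
  ring

/-- Bessel's inequality for the energy form of the Zernike operator. -/
lemma IsWeakGradient.sum_inner_zernike_le {u gx gy : L2Disk} (h : IsWeakGradient u gx gy)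
    (s : Finset (Σ n : ℕ, Fin (n + 1))) :
    ∑ i ∈ s, (i.1 : ℝ) * (i.1 + 2) * ‖(inner ℂ (zernikeHat i.1 i.2) u : ℂ)‖ ^ 2 ≤
      ‖gx‖ ^ 2 + ‖gy‖ ^ 2 := by
  set S : ℝ := ∑ i ∈ s, (i.1 : ℝ) * (i.1 + 2) * ‖(inner ℂ (zernikeHat i.1 i.2) u : ℂ)‖ ^ 2 with hS
  -- Chosen so that `∑ a i • Z_i` is the orthogonal projection of `u` onto the span of the Zernike
  -- functions in `s`. Below, `P₁, P₂` form its gradient, `X₁, X₂` its flux, and `E` is its Euler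
  -- derivative.
  set a : (Σ n : ℕ, Fin (n + 1)) → ℂ := fun i =>
    ((‖zernike i.1 i.2‖⁻¹ : ℝ) : ℂ) * inner ℂ (zernikeHat i.1 i.2) u with ha
  set X₁ : C(ℂ, ℂ) := ∑ i ∈ s, a i • fluxX i.1 i.2 with hX₁
  set X₂ : C(ℂ, ℂ) := ∑ i ∈ s, a i • fluxY i.1 i.2 with hX₂
  set P₁ : C(ℂ, ℂ) := ∑ i ∈ s, a i • zernikeDx i.1 i.2 with hP₁
  set P₂ : C(ℂ, ℂ) := ∑ i ∈ s, a i • zernikeDy i.1 i.2 with hP₂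
  set E : C(ℂ, ℂ) := ∑ i ∈ s, a i • zernikeEuler i.1 i.2 with hE
  have hZ (i : Σ n : ℕ, Fin (n + 1)) (v : L2Disk) (hv : inner ℂ (zernikeHat i.1 i.2) v =
      inner ℂ (zernikeHat i.1 i.2) u) : starRingEnd ℂ (a i) * inner ℂ (zernike i.1 i.2) v =
      ((‖(inner ℂ (zernikeHat i.1 i.2) u : ℂ)‖ ^ 2 : ℝ) : ℂ) := by
    have hk := Nat.lt_succ_iff.1 i.2.2
    have hne : ((‖zernike i.1 i.2‖ : ℝ) : ℂ) ≠ 0 :=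
      Complex.ofReal_ne_zero.2 (norm_zernike_pos hk).ne'
    conv_lhs => rw [zernike_eq_smul_hat hk, inner_smul_left, hv]
    rw [ha]
    simp only [map_mul, Complex.conj_ofReal]
    rw [Complex.ofReal_inv]
    push_cast
    rw [← Complex.conj_mul']
    field_simp
  -- The pairing of the flux with `∇v` depends only on the coefficients of `v` in `s`, so it takes
  -- the same value `S` for `u` and for its projection.
  have hpair {v vx vy : L2Disk} (hv : IsWeakGradient v vx vy)
      (hc : ∀ i ∈ s, inner ℂ (zernikeHat i.1 i.2) v = inner ℂ (zernikeHat i.1 i.2) u) :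
      inner ℂ (contL2 X₁) vx + inner ℂ (contL2 X₂) vy = (S : ℂ) := by
    rw [hX₁, hX₂, map_sum, map_sum, sum_inner, sum_inner, ← Finset.sum_add_distrib, hS,
      Complex.ofReal_sum]
    refine Finset.sum_congr rfl fun i hi => ?_
    rw [map_smul, map_smul, inner_smul_left, inner_smul_left, ← mul_add, hv.inner_flux]
    have := hZ i v (hc i hi)
    push_cast at this ⊢
    linear_combination (i.1 : ℂ) * (i.1 + 2) * this
  have hu := hpair h fun i _ => rfl
  have hP : IsWeakGradient (∑ i ∈ s, a i • zernike i.1 i.2) (contL2 P₁) (contL2 P₂) := by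
    rw [hP₁, hP₂, map_sum, map_sum]
    simp only [map_smul]
    exact IsWeakGradient.sum s fun i => (isWeakGradient_zernike i.1 i.2).smul (a i)
  have hpP := hpair hP fun i hi => by
    have : ∑ i ∈ s, a i • zernike i.1 i.2 =
        ∑ i ∈ s, (inner ℂ (zernikeHat i.1 i.2) u : ℂ) • zernikeHat i.1 i.2 := by
      refine Finset.sum_congr rfl fun i _ => ?_
      rw [ha, zernikeHat]
      simp only
      rw [smul_smul, mul_comm, zernikeHat]
    rw [this]
    exact zernikeHat_orthonormal.inner_right_sum _ hi
  have hdiff₁ : P₁ = X₁ + reC * E := by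
    rw [hP₁, hX₁, hE, Finset.mul_sum, ← Finset.sum_add_distrib]
    refine Finset.sum_congr rfl fun i _ => ?_
    rw [fluxX, mul_smul_comm, smul_sub, sub_add_cancel]
  have hdiff₂ : P₂ = X₂ + imC * E := by
    rw [hP₂, hX₂, hE, Finset.mul_sum, ← Finset.sum_add_distrib]
    refine Finset.sum_congr rfl fun i _ => ?_
    rw [fluxY, mul_smul_comm, smul_sub, sub_add_cancel]
  have hE' (z : ℂ) : z.re * P₁ z + z.im * P₂ z = E z := by
    rw [hP₁, hP₂, hE, ContinuousMap.sum_apply, ContinuousMap.sum_apply, ContinuousMap.sum_apply,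
      Finset.mul_sum, Finset.mul_sum, ← Finset.sum_add_distrib]
    refine Finset.sum_congr rfl fun i _ => ?_
    rw [ContinuousMap.smul_apply, ContinuousMap.smul_apply, ContinuousMap.smul_apply,
      smul_eq_mul, smul_eq_mul, smul_eq_mul, ← zernike_euler]
    ring
  -- Gradient and flux differ by `x E`, whose pairing with the flux is nonnegative. Hence `‖X‖² ≤
  -- S`.
  have hrad : inner ℂ (contL2 X₁) (contL2 (reC * E)) + inner ℂ (contL2 X₂) (contL2 (imC * E)) =
      ((∫ z, (1 - ‖z‖ ^ 2) * ‖E z‖ ^ 2 ∂diskMeasure : ℝ) : ℂ) := by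
    have hint (f : C(ℂ, ℂ)) (v : L2Disk) :
        Integrable (fun z => starRingEnd ℂ (f z) * v z) diskMeasure :=
      integrable_mul_L2Disk _ (Complex.continuous_conj.comp f.continuous) v
    rw [inner_contL2_left, inner_contL2_left, ← integral_add (hint _ _) (hint _ _),
      ← integral_complex_ofReal]
    refine integral_congr_ae ?_
    filter_upwards [coeFn_contL2 (reC * E), coeFn_contL2 (imC * E)] with z h1 h2
    rw [h1, h2, ContinuousMap.mul_apply, ContinuousMap.mul_apply, reC_apply, imC_apply, sq_norm_eq]
    push_cast
    rw [← Complex.conj_mul']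
    have e1 : z.re * X₁ z + z.im * X₂ z = (1 - ((z.re : ℂ) ^ 2 + (z.im : ℂ) ^ 2)) * E z := by
      have h3 := hE' z
      rw [hdiff₁, hdiff₂] at h3
      simp only [ContinuousMap.add_apply, ContinuousMap.mul_apply, reC_apply, imC_apply] at h3
      linear_combination h3
    have e2 := congrArg (starRingEnd ℂ) e1
    simp only [map_add, map_sub, map_mul, map_pow, map_one, Complex.conj_ofReal] at e2
    linear_combination E z * e2
  have hnn : 0 ≤ ∫ z, (1 - ‖z‖ ^ 2) * ‖E z‖ ^ 2 ∂diskMeasure := by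
    refine integral_nonneg_of_ae ?_
    filter_upwards [ae_disk_mem_closedBall] with z hz
    rw [mem_closedBall_zero_iff] at hz
    have : ‖z‖ ^ 2 ≤ 1 := by nlinarith [norm_nonneg z]
    exact mul_nonneg (by linarith) (by positivity)
  have hnorm : ‖contL2 X₁‖ ^ 2 + ‖contL2 X₂‖ ^ 2 ≤ S := by
    rw [hdiff₁, hdiff₂, map_add, map_add, inner_add_right, inner_add_right, add_add_add_comm,
      hrad, inner_self_eq_norm_sq_to_K, inner_self_eq_norm_sq_to_K] at hpP
    have : ‖contL2 X₁‖ ^ 2 + ‖contL2 X₂‖ ^ 2 +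
        ∫ z, (1 - ‖z‖ ^ 2) * ‖E z‖ ^ 2 ∂diskMeasure = S := by
      refine Complex.ofReal_injective ?_
      rw [Complex.ofReal_add, Complex.ofReal_add, Complex.ofReal_pow, Complex.ofReal_pow]
      exact hpP
    linarith
  have hS0 : 0 ≤ S := le_trans (by positivity) hnorm
  have hcs : S ≤ ‖contL2 X₁‖ * ‖gx‖ + ‖contL2 X₂‖ * ‖gy‖ := by
    have : S = ‖(S : ℂ)‖ := by rw [Complex.norm_real, Real.norm_of_nonneg hS0]
    rw [this, ← hu]
    exact (norm_add_le _ _).trans (add_le_add (norm_inner_le_norm _ _) (norm_inner_le_norm _ _))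
  -- From `‖X‖² ≤ S ≤ ‖X₁‖‖gx‖ + ‖X₂‖‖gy‖` one gets `S ≤ (S + ‖gx‖² + ‖gy‖²) / 2`.
  nlinarith [sq_nonneg (‖contL2 X₁‖ - ‖gx‖), sq_nonneg (‖contL2 X₂‖ - ‖gy‖)]

lemma H1_subset_Htilde : H1 ⊆ Htilde 1 := by
  rintro u ⟨gx, gy, h⟩
  refine ⟨fun i => inner ℂ (zernikeHat i.1 i.2) u, hasSum_zernikeHat u, ?_⟩
  refine summable_of_sum_le (c := ‖gx‖ ^ 2 + ‖gy‖ ^ 2 + ‖u‖ ^ 2) (fun i => by positivity)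
    fun s => ?_
  have h1 := h.sum_inner_zernike_le s
  have h2 := zernikeHat_orthonormal.sum_inner_products_le u (s := s)
  refine le_trans (le_of_eq ?_) (add_le_add h1 h2)
  rw [← Finset.sum_add_distrib]
  refine Finset.sum_congr rfl fun i _ => ?_
  -- The weights match because `(n+1)² = n(n+2) + 1`.
  rw [rpow_two_mul_one]
  ring

/-! ### Growth of the gradients of the radial Zernike functions -/

/-- The derivative `∂ₓ - i ∂_y` of the radial Zernike function of degree `2m`. -/
def radialDbar (m : ℕ) : C(ℂ, ℂ) := zernikeDx (2 * m) m - Complex.I • zernikeDy (2 * m) m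

lemma radialDbar_zero : radialDbar 0 = 0 := by
  ext z
  simp [radialDbar, zernikeDx, zernikeDy, ridge_apply, ridgeFun]

lemma radialDbar_apply (m : ℕ) (z : ℂ) : radialDbar m z =
    ridgeFun (zernikeWeight (2 * m) m * (sinC + Complex.I • cosC))
      (derivative (U ℂ (2 * m : ℕ))) z := by
  rw [mul_add, mul_smul_comm, ridgeFun_add_left, ridgeFun_smul_left]
  simp [radialDbar, zernikeDx, zernikeDy, ridge_apply]

/-- The factor `sin b + i cos b = i e^{-ib}` turns the radial weight into one of frequency `-1`. The
profile obeys `U_{2m+2}' = 4(m+1) U_{2m+1} + U_{2m}'`, the derivative of `U_{n+2} = 2T_{n+2} + U_n`.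
The minus sign comes from `(-i)² = -1` in the normalization of the weights. -/
lemma radialDbar_succ (m : ℕ) : radialDbar (m + 1) =
    (4 * (m + 1) : ℂ) • zernikeC (2 * m + 1) (m + 1) - radialDbar m := by
  have hexp (b : ℝ) : (sinC + Complex.I • cosC) b = Complex.I * Complex.exp (-(Complex.I * b)) := by
    simp only [ContinuousMap.add_apply, ContinuousMap.smul_apply, sinC_apply, cosC_apply,
      smul_eq_mul, Complex.ofReal_sin, Complex.ofReal_cos]
    rw [show -(Complex.I * (b : ℂ)) = -(b : ℂ) * Complex.I by ring, Complex.exp_mul_I,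
      Complex.cos_neg, Complex.sin_neg]
    linear_combination Complex.sin b * Complex.I_sq
  have hw₁ : zernikeWeight (2 * (m + 1)) (m + 1) * (sinC + Complex.I • cosC) =
      zernikeWeight (2 * m + 1) (m + 1) := by
    ext b
    rw [ContinuousMap.mul_apply, hexp, zernikeWeight_apply, zernikeWeight_apply]
    have e : Complex.exp (Complex.I * ((2 * m + 1 : ℕ) - 2 * (m + 1 : ℕ)) * b) =
        Complex.exp (Complex.I * ((2 * (m + 1) : ℕ) - 2 * (m + 1 : ℕ)) * b) *
          Complex.exp (-(Complex.I * b)) := by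
      rw [← Complex.exp_add]; congr 1; push_cast; ring
    rw [e, show 2 * (m + 1) = 2 * m + 1 + 1 by ring, pow_succ (-Complex.I) (2 * m + 1)]
    linear_combination (-(-Complex.I) ^ (2 * m + 1) / (2 * Real.pi) *
      Complex.exp (Complex.I * ((2 * m + 1 + 1 : ℕ) - 2 * (m + 1 : ℕ)) * b) *
      Complex.exp (-(Complex.I * b))) * Complex.I_sq
  have hw₂ : zernikeWeight (2 * m) m * (sinC + Complex.I • cosC) =
      (-1 : ℂ) • zernikeWeight (2 * m + 1) (m + 1) := by
    rw [← hw₁, ← smul_mul_assoc]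
    congr 1
    ext b
    rw [ContinuousMap.smul_apply, zernikeWeight_apply, zernikeWeight_apply, smul_eq_mul,
      show 2 * (m + 1) = 2 * m + 2 by ring, pow_add, neg_sq, Complex.I_sq]
    push_cast
    ring_nf
  have hU : derivative (U ℂ (2 * (m + 1) : ℕ)) =
      C (4 * (m + 1) : ℂ) * U ℂ (2 * m + 1 : ℕ) + derivative (U ℂ (2 * m : ℕ)) := by
    have h := congrArg derivative (Chebyshev.U_eq_two_mul_T_add_U ℂ ((2 * m : ℕ) : ℤ))
    rw [derivative_add, derivative_mul, Chebyshev.T_derivative_eq_U] at h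
    rw [show ((2 * (m + 1) : ℕ) : ℤ) = ((2 * m : ℕ) : ℤ) + 2 by push_cast; ring, h,
      show ((2 * m : ℕ) : ℤ) + 2 - 1 = ((2 * m + 1 : ℕ) : ℤ) by push_cast; ring]
    have h2 : derivative (2 : ℂ[X]) = 0 := by
      rw [← C_ofNat, derivative_C]
    rw [h2]
    simp only [C_mul, C_add, map_natCast, map_ofNat, C_1]
    push_cast
    ring
  ext z
  rw [ContinuousMap.sub_apply, ContinuousMap.smul_apply, radialDbar_apply, radialDbar_apply, hw₁,
    hw₂, hU, ridgeFun_add_right, ridgeFun_C_mul_right, ridgeFun_smul_left, zernikeC, ridge_apply,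
    smul_eq_mul]
  ring

/-- By the recursion `radialDbar m` is a combination of Zernike functions of degree at most `2m -
1`, hence below `2j + 1`. -/
lemma inner_zernike_radialDbar (m j : ℕ) (h : m ≤ j) :
    inner ℂ (zernike (2 * j + 1) (j + 1)) (contL2 (radialDbar m)) = 0 := by
  induction m with
  | zero => rw [radialDbar_zero, map_zero, inner_zero_right]
  | succ m ih =>
    rw [radialDbar_succ, map_sub, map_smul, ← zernike_eq_contL2, inner_sub_right, ih (by omega),
      inner_smul_right, inner_zernike (by omega), inner_psi_of_ne (by omega) (by omega) (by omega)]
    ring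

/-- Pythagoras in the recursion: the step from `m` to `m + 1` adds `16(m+1)² π/(2m+2) = 8π(m+1)`. -/
lemma norm_radialDbar_sq (m : ℕ) : ‖contL2 (radialDbar m)‖ ^ 2 = 4 * Real.pi * (m * (m + 1)) := by
  induction m with
  | zero => simp [radialDbar_zero]
  | succ m ih =>
    rw [radialDbar_succ, map_sub, map_smul, ← zernike_eq_contL2,
      @norm_sub_sq ℂ, inner_smul_left, inner_zernike_radialDbar m m le_rfl, ih, norm_smul, mul_pow,
      norm_zernike_sq (by omega)]
    have : ‖(4 * (m + 1) : ℂ)‖ = 4 * (m + 1) := by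
      rw [show (4 * (m + 1) : ℂ) = ((4 * (m + 1) : ℝ) : ℂ) by push_cast; ring, Complex.norm_real,
        Real.norm_of_nonneg (by positivity)]
    rw [this]
    push_cast
    simp only [mul_zero, map_zero, sub_zero]
    have h1 : (2 * (m : ℝ) + 1 + 1) ≠ 0 := by positivity
    field_simp
    ring

/-- From `‖a - ib‖² ≤ 2(‖a‖² + ‖b‖²)`, which accounts for the lost factor `2`. -/
lemma gradient_zernike_radial_ge (m : ℕ) : 2 * Real.pi * (m * (m + 1)) ≤
    ‖contL2 (zernikeDx (2 * m) m)‖ ^ 2 + ‖contL2 (zernikeDy (2 * m) m)‖ ^ 2 := by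
  have h := norm_radialDbar_sq m
  rw [radialDbar, map_sub, map_smul] at h
  have h2 := norm_sub_le (contL2 (zernikeDx (2 * m) m)) (Complex.I • contL2 (zernikeDy (2 * m) m))
  rw [norm_smul, Complex.norm_I, one_mul] at h2
  have h3 := pow_le_pow_left₀ (norm_nonneg _) h2 2
  nlinarith [sq_nonneg (‖contL2 (zernikeDx (2 * m) m)‖ - ‖contL2 (zernikeDy (2 * m) m)‖)]

/-- The norm inequality `‖I₀* I₀ Z‖_{H¹} ≤ C ‖Z‖_{L²}` fails on radial Zernike functions. -/
lemma exists_radial_zernike_lt (C : ℝ) : ∃ m : ℕ, ∃ gx gy : L2Disk,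
    IsWeakGradient (normalOp (zernike (2 * m) m)) gx gy ∧
    C * ‖zernike (2 * m) m‖ <
      Real.sqrt (‖normalOp (zernike (2 * m) m)‖ ^ 2 + ‖gx‖ ^ 2 + ‖gy‖ ^ 2) := by
  -- With `q = 2m + 1`, it suffices that `C² q < 32π² m(m+1)`. Since `m q ≤ 2m(m+1)`, any `m > C²`
  -- works, and the `1` keeps `m` nonzero.
  obtain ⟨m, hm⟩ := exists_nat_gt (max (C ^ 2) 1)
  have hm1 : C ^ 2 < m := (le_max_left _ _).trans_lt hm
  have hm2 : (1 : ℝ) < m := (le_max_right _ _).trans_lt hm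
  have hmle : m ≤ 2 * m := by omega
  have hg := (isWeakGradient_zernike (2 * m) m).smul (eigenvalue (2 * m) : ℂ)
  rw [← normalOp_zernike hmle] at hg
  refine ⟨m, _, _, hg, Real.lt_sqrt_of_sq_lt ?_⟩
  rw [mul_pow, norm_zernike_sq hmle, norm_smul, norm_smul, Complex.norm_real,
    Real.norm_of_nonneg (eigenvalue_pos _).le]
  have hgrad := gradient_zernike_radial_ge m
  set A := ‖contL2 (zernikeDx (2 * m) m)‖
  set B := ‖contL2 (zernikeDy (2 * m) m)‖
  set q : ℝ := ((2 * m : ℕ) : ℝ) + 1 with hq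
  have hq0 : 0 < q := by positivity
  have hqm : q = 2 * m + 1 := by rw [hq]; push_cast; ring
  have hπ := Real.pi_gt_three
  have key : C ^ 2 * (Real.pi / q) < eigenvalue (2 * m) ^ 2 * (2 * Real.pi * (m * (m + 1))) := by
    have he : eigenvalue (2 * m) = 4 * Real.pi / q := rfl
    rw [he, div_pow, ← mul_div_assoc, div_mul_eq_mul_div, div_lt_div_iff₀ hq0 (by positivity)]
    have h1 : C ^ 2 * q < 32 * Real.pi ^ 2 * (m * (m + 1)) := by
      have e1 : C ^ 2 * q ≤ m * q := mul_le_mul_of_nonneg_right hm1.le hq0.le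
      have e2 : (m : ℝ) * q ≤ 2 * (m * (m + 1)) := by rw [hqm]; nlinarith
      have e3 : (0 : ℝ) < m * (m + 1) := by positivity
      have e4 : (2 : ℝ) < 32 * Real.pi ^ 2 := by nlinarith
      nlinarith [mul_lt_mul_of_pos_right e4 e3]
    have h2 := mul_lt_mul_of_pos_right h1 (by positivity : 0 < Real.pi * q)
    linarith
  have h3 := mul_le_mul_of_nonneg_left hgrad (sq_nonneg (eigenvalue (2 * m)))
  nlinarith [sq_nonneg ‖normalOp (zernike (2 * m) m)‖]

/-! ### Unboundedness into `H1` and strictness of the inclusion -/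

lemma not_isBoundedL2H1_normalOp : ¬ IsBoundedL2H1 normalOp := by
  rintro ⟨C, -, hC⟩
  obtain ⟨m, gx, gy, hg, hlt⟩ := exists_radial_zernike_lt C
  obtain ⟨gx', gy', hg', hle⟩ := hC (zernike (2 * m) m)
  rw [hg.1.unique hg'.1, hg.2.unique hg'.2] at hlt
  exact not_lt.2 hle hlt

/-- No explicit function outside `H1` is exhibited: if `Htilde 1`, the range of the normal operator,
were contained in `H1`, the closed graph theorem would contradict unboundedness. -/
lemma H1_ssubset_Htilde : H1 ⊂ Htilde 1 := by
  refine ⟨H1_subset_Htilde, fun h => not_isBoundedL2H1_normalOp ?_⟩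
  refine isBoundedL2H1_of_forall_mem_H1 normalOp fun f => h ?_
  rw [← range_normalOp]
  exact mem_range_self f

end DiskXRay

end

theorem proposition3p6 :
    ¬ DiskXRay.IsBoundedL2H1 DiskXRay.normalOp ∧
    (∀ C : ℝ, ∃ m : ℕ, ∃ gx gy : DiskXRay.L2Disk,
      DiskXRay.IsWeakGradient (DiskXRay.normalOp (DiskXRay.zernike (2 * m) m)) gx gy ∧
      C * ‖DiskXRay.zernike (2 * m) m‖ <
        Real.sqrt (‖DiskXRay.normalOp (DiskXRay.zernike (2 * m) m)‖ ^ 2 +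
          ‖gx‖ ^ 2 + ‖gy‖ ^ 2)) ∧
    DiskXRay.H1 ⊂ DiskXRay.Htilde 1 ∧
    Set.range DiskXRay.normalOp = DiskXRay.Htilde 1 :=
  ⟨DiskXRay.not_isBoundedL2H1_normalOp, DiskXRay.exists_radial_zernike_lt,
    DiskXRay.H1_ssubset_Htilde, DiskXRay.range_normalOp⟩
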